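/- **Setting.** Let $A\in\mathbb R^{N\times N}$ be the transition matrix of a Markov chain $\{Y_i\}_{i=1}^\infty$ on $[N]$ which is stationary and reversible with respect to a probability vector $\mu$: $\mu A=\mu$, $\mu_vA_{vw}=\mu_wA_{wv}$ for all $v,w$, and $Y_1$ has distribution $\mu$. For nonnegative weights $w$ put $\|x\|_{L_2(w)}=(\sum_i |x_i|^2 w_i)^{1/2}$. Let $E_\mu=\mathbf 1\mu^*$ be the matrix all of whose rows equal $\mu$, and let $$\lambda=\|A-E_\mu\|_{L_2(\mu)\to L_2(\mu)}=\sup\{\|(A-E_\mu)x\|_{L_2(\mu)}:\|x\|_{L_2(\mu)}\le 1\}$$ (one always has $0\le\lambda\le1$). For a nonempty set $T$ with a (pseudo)metric $d$ and $\alpha>0$ put $$\gamma_\alpha(T,d)=\inf\ \sup_{t\in T}\ \sum_{i=0}^\infty 2^{i/\alpha}\min_{t'\in T_i}d(t,t')\in[0,\infty],$$ the infimum being over all sequences of finite subsets $T_0\subseteq T_1\subseteq\cdots\subseteq T$ with $|T_0|=1$ and $|T_i|\le 2^{2^i}$ for $i\ge1$. On $\mathbb R^{n\times N}$, let $\ell_\infty$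 denote the distance $\max_{i,v}|s(i,v)-t(i,v)|$ (which is $0$ if $n=0$) and $L_2((1,\dots,1)\otimes\mu)$ the distance $\big(\sum_{i=1}^n\sum_{v=1}^N\mu_v (s(i,v)-t(i,v))^2\big)^{1/2}$. **Statement.** There are universal constants $C_1,C_2,C_3>0$ such that the following holds for all $n$, $N$ and every chain as above. Let $T\subseteq\mathbb R^{n\times N}$ be a symmetric set ($T=-T$) containing $0$ such that $\mathbb E_{v\sim\mu}[t(i,v)]=0$ for all $t\in T$ and all $i\in[n]$. For $t\in T$ let $W_t=\sum_{i=1}^n t(i,Y_i)$, and write $\gamma_1=\gamma_1(T,\ell_\infty)$ and $\gamma_2=\gamma_2(T,L_2((1,\dots,1)\otimes\mu))$. Then $$\mathbb E\Big[\sup_{t\in T}|W_t|\Big]\le C_1\left(\frac{\gamma_1}{1-\lambda}+\frac{\gamma_2}{\sqrt{1-\lambda}}\right),$$ and, for every $u\ge0$, $$\Pr\Big[\sup_{t\in T}|W_t|\ge u\Big]\le C_2\exp\left(-C_3(1-\lambda)\min\left\{\frac{u}{\gamma_1},\frac{u^2}{\gamma_2^2}\right\}\right).$$ Both inequalities are between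 quantities in $[0,\infty]$, with the conventions $a/0=\infty$ for $a>0$, $0/0=0$, $a/\infty=0$ for finite $a$, $0\cdot\infty=0$ and $e^{-\infty}=0$; in particular $\lambda=1$, unbounded $T$ and $T=\{0\}$ are allowed. -/

import Mathlib

open MeasureTheory
open scoped ENNReal

namespace MarkovChaining

/-- The norm `‖x‖_{L₂(w)} = (∑ i, |x i|² w i)^{1/2}` for nonnegative weights `w`. -/
noncomputable def l2Norm {ι : Type*} [Fintype ι] (w x : ι → ℝ) : ℝ :=
  Real.sqrt (∑ i, |x i| ^ 2 * w i)

/-- The `L₂(w) → L₂(w)` operator norm `sup {‖M x‖_{L₂(w)} : ‖x‖_{L₂(w)} ≤ 1}`. -/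
noncomputable def l2OpNorm {ι : Type*} [Fintype ι] (w : ι → ℝ) (M : Matrix ι ι ℝ) : ℝ :=
  sSup {r : ℝ | ∃ x : ι → ℝ, l2Norm w x ≤ 1 ∧ r = l2Norm w (M.mulVec x)}

/-- The averaging operator `E_μ = 𝟏 μ*`, every row of which is `μ`. -/
def averaging {N : ℕ} (μ : Fin N → ℝ) : Matrix (Fin N) (Fin N) ℝ :=
  Matrix.vecMulVec 1 μ

/-- The spectral parameter `λ = ‖A - E_μ‖_{L₂(μ) → L₂(μ)}`. -/
noncomputable def spectralParam {N : ℕ} (A : Matrix (Fin N) (Fin N) ℝ) (μ : Fin N → ℝ) : ℝ :=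
  l2OpNorm μ (A - averaging μ)

/-- `A` is a transition matrix, and `μ` is a stationary probability vector of it with respect to
which it is reversible (detailed balance). Entries of `μ` may vanish. -/
structure IsReversible {N : ℕ} (A : Matrix (Fin N) (Fin N) ℝ) (μ : Fin N → ℝ) : Prop where
  nonneg : ∀ v w, 0 ≤ A v w
  row_sum : ∀ v, ∑ w, A v w = 1
  mu_nonneg : ∀ v, 0 ≤ μ v
  mu_sum : ∑ v, μ v = 1
  stationary : Matrix.vecMul μ A = μ
  detailed_balance : ∀ v w, μ v * A v w = μ w * A w v

/-- `Y` is a Markov chain with state space `[N]`, initial distribution `μ` and transition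
matrix `A`. Time starts at `0`, so `Y i` is the `(i + 1)`-st variable of the chain. The field `step`
is `P(Y_{k+1} = x_{k+1} | Y_0 = x_0, …, Y_k = x_k) = A(x_k, x_{k+1})`, multiplied out so that paths
of probability zero need no exception. -/
structure IsMarkovChain {N : ℕ} {Ω : Type*} [MeasurableSpace Ω] (P : Measure Ω)
    (A : Matrix (Fin N) (Fin N) ℝ) (μ : Fin N → ℝ) (Y : ℕ → Ω → Fin N) : Prop where
  measurable : ∀ i, Measurable (Y i)
  init : ∀ v, P {ω | Y 0 ω = v} = ENNReal.ofReal (μ v)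
  step : ∀ (k : ℕ) (x : ℕ → Fin N),
    P {ω | ∀ j ≤ k + 1, Y j ω = x j} =
      P {ω | ∀ j ≤ k, Y j ω = x j} * ENNReal.ofReal (A (x k) (x (k + 1)))

/-- Sequences `S₀ ⊆ S₁ ⊆ ⋯ ⊆ T` with `|S₀| = 1` and `|Sᵢ| ≤ 2^(2^i)` for `i ≥ 1`. -/
structure IsAdmissible {E : Type*} (T : Set E) (S : ℕ → Finset E) : Prop where
  mono : ∀ i, S i ⊆ S (i + 1)
  subset : ∀ i, (S i : Set E) ⊆ T
  card_zero : (S 0).card = 1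
  card_le : ∀ i, 1 ≤ i → (S i).card ≤ 2 ^ 2 ^ i

/-- Talagrand's functional
`γ_α(T, d) = inf sup_{t ∈ T} ∑ i, 2^(i/α) min_{t' ∈ Sᵢ} d(t, t')`, the infimum being over all
admissible sequences; it takes values in `[0, ∞]`. -/
noncomputable def gammaFunctional {E : Type*} (α : ℝ) (T : Set E) (d : E → E → ℝ) : ℝ≥0∞ :=
  ⨅ (S : ℕ → Finset E) (_ : IsAdmissible T S),
    ⨆ t ∈ T, ∑' i : ℕ, (2 : ℝ≥0∞) ^ ((i : ℝ) / α) * ⨅ t' ∈ S i, ENNReal.ofReal (d t t')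

/-- The `ℓ_∞` distance on `ℝ^{n × N}`; `‖·‖` is the maximum norm on this function space. -/
noncomputable def linftyDist {n N : ℕ} (s t : Fin n × Fin N → ℝ) : ℝ :=
  ‖s - t‖

/-- The `L₂((1, …, 1) ⊗ μ)` distance on `ℝ^{n × N}`. -/
noncomputable def l2Dist {n N : ℕ} (μ : Fin N → ℝ) (s t : Fin n × Fin N → ℝ) : ℝ :=
  l2Norm (fun p : Fin n × Fin N => 1 * μ p.2) (s - t)

/-- `γ₁(T, ℓ_∞)`. -/
noncomputable def gammaOne {n N : ℕ} (T : Set (Fin n × Fin N → ℝ)) : ℝ≥0∞ :=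
  gammaFunctional 1 T linftyDist

/-- `γ₂(T, L₂((1, …, 1) ⊗ μ))`. -/
noncomputable def gammaTwo {n N : ℕ} (μ : Fin N → ℝ) (T : Set (Fin n × Fin N → ℝ)) : ℝ≥0∞ :=
  gammaFunctional 2 T (l2Dist μ)

/-- `W_t = ∑ i, t(i, Y_i)`. -/
def chainSum {n N : ℕ} {Ω : Type*} (Y : ℕ → Ω → Fin N) (t : Fin n × Fin N → ℝ) (ω : Ω) : ℝ :=
  ∑ i : Fin n, t (i, Y i ω)

/-- `sup_{t ∈ T} |W_t|`, with values in `[0, ∞]`. -/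
noncomputable def supChainSum {n N : ℕ} {Ω : Type*} (Y : ℕ → Ω → Fin N)
    (T : Set (Fin n × Fin N → ℝ)) (ω : Ω) : ℝ≥0∞ :=
  ⨆ t ∈ T, ENNReal.ofReal |chainSum Y t ω|

end MarkovChaining

/-!
The sum `W_t` has Bernstein tails, of Gaussian type with variance `‖t‖² / (1 - λ)` in `L₂` and of
exponential type with scale `‖t‖_∞ / (1 - λ)`; generic chaining turns such mixed tails into the two
functionals `γ₂` and `γ₁`.

*Tails of a single sum.* By the Markov property `E exp (θ W_t)` is the mean of the product of the
operators `h ↦ exp (θ t_i) · A h` applied to the constant `1`. On the orthogonal decomposition of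
`L₂(μ)` into constants and centred functions, `A` fixes the former and contracts the latter by `λ`. As `t_i` is
centred, a tilt with `|θ t_i| ≤ (1 - λ) / 8` moves mass between the two parts only to first order,
and the gap absorbs this: each operator has norm at most `exp (18 θ² E t_i² / (1 - λ))`
(`IsReversible.l2Norm_exp_mul_mulVec_le`). Multiplying the norms bounds the Laplace transform
(`IsMarkovChain.mgf_chainSum_le`), and Chernoff's bound gives the tails
(`IsMarkovChain.measure_lt_abs_chainSum_le`).

*One net for two distances.* The functionals `γ₁` and `γ₂` come with separate admissible sequences,
while a chain needs points of `T` that are close in both distances at once. Intersecting the two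
families of Voronoi cells is not enough, because a representative of an intersection may be much
farther from the centre than the point that it represents. Sorting the points also by their rounded
distances to the two centres cures this, at the price of replacing `2 ^ 2 ^ i` by `2 ^ 2 ^ (i + 3)`
in the bound on the cardinality (`exists_common_net`).

*Chaining.* A union bound over all links of all levels shows that, outside an event of probability
`4 exp (-v)`, every link obeys its Bernstein bound with parameter `v 2 ^ i`. Summing along the chains
gives `|W_t| ≤ C (v γ₁ / (1 - λ) + √v γ₂ / √(1 - λ))` for all `t` simultaneously
(`IsMarkovChain.measure_lt_supChainSum_le`). Solving for `v` gives the tail bound, and integrating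
over `v` gives the bound in mean.
-/

namespace MarkovChaining

/-! ### The weighted `L₂` norm -/

theorem l2Norm_nonneg {ι : Type*} [Fintype ι] (w x : ι → ℝ) : 0 ≤ l2Norm w x :=
  Real.sqrt_nonneg _

theorem l2Norm_sq {ι : Type*} [Fintype ι] {w : ι → ℝ} (hw : ∀ i, 0 ≤ w i) (x : ι → ℝ) :
    l2Norm w x ^ 2 = ∑ i, w i * x i ^ 2 := by
  rw [l2Norm, Real.sq_sqrt (Finset.sum_nonneg fun i _ => mul_nonneg (sq_nonneg _) (hw i))]
  exact Finset.sum_congr rfl fun i _ => by rw [sq_abs, mul_comm]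

theorem l2Norm_neg {ι : Type*} [Fintype ι] (w x : ι → ℝ) : l2Norm w (-x) = l2Norm w x := by
  simp [l2Norm]

theorem l2Norm_smul {ι : Type*} [Fintype ι] {w : ι → ℝ} (hw : ∀ i, 0 ≤ w i) {c : ℝ} (hc : 0 ≤ c)
    (x : ι → ℝ) : l2Norm w (c • x) = c * l2Norm w x := by
  rw [← sq_eq_sq₀ (l2Norm_nonneg _ _) (mul_nonneg hc (l2Norm_nonneg _ _)), mul_pow, l2Norm_sq hw,
    l2Norm_sq hw, Finset.mul_sum]
  exact Finset.sum_congr rfl fun i _ => by simp only [Pi.smul_apply, smul_eq_mul]; ring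

/-- The weighted norm is the Euclidean norm of the vector rescaled by `√w`. -/
theorem l2Norm_eq_norm {ι : Type*} [Fintype ι] {w : ι → ℝ} (hw : ∀ i, 0 ≤ w i) (x : ι → ℝ) :
    l2Norm w x = ‖(WithLp.toLp 2 fun i => Real.sqrt (w i) * x i : EuclideanSpace ℝ ι)‖ := by
  rw [EuclideanSpace.norm_eq, l2Norm]
  congr 1
  refine Finset.sum_congr rfl fun i _ => ?_
  rw [Real.norm_eq_abs, sq_abs, sq_abs, mul_pow, Real.sq_sqrt (hw i), mul_comm]

theorem l2Norm_add_le {ι : Type*} [Fintype ι] {w : ι → ℝ} (hw : ∀ i, 0 ≤ w i) (x y : ι → ℝ) :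
    l2Norm w (x + y) ≤ l2Norm w x + l2Norm w y := by
  rw [l2Norm_eq_norm hw, l2Norm_eq_norm hw, l2Norm_eq_norm hw]
  refine le_of_eq_of_le (congrArg norm ?_) (norm_add_le _ _)
  ext i
  simp [mul_add]

/-! ### The spectral parameter -/

variable {N : ℕ} {A : Matrix (Fin N) (Fin N) ℝ} {μ : Fin N → ℝ}

theorem IsReversible.sum_mulVec (hA : IsReversible A μ) (x : Fin N → ℝ) :
    ∑ v, μ v * A.mulVec x v = ∑ v, μ v * x v := by
  have h := Matrix.dotProduct_mulVec μ A x
  rw [hA.stationary] at h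
  exact h

/-- `A` is a contraction of `L₂(μ)`: Jensen's inequality for each row, then stationarity. -/
theorem IsReversible.sum_sq_mulVec_le (hA : IsReversible A μ) (x : Fin N → ℝ) :
    ∑ v, μ v * A.mulVec x v ^ 2 ≤ ∑ v, μ v * x v ^ 2 := by
  rw [← hA.sum_mulVec fun v => x v ^ 2]
  refine Finset.sum_le_sum fun v _ => mul_le_mul_of_nonneg_left ?_ (hA.mu_nonneg v)
  exact Real.pow_arith_mean_le_arith_mean_pow_of_even Finset.univ (A v) x
    (fun w _ => hA.nonneg v w) (hA.row_sum v) even_two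

theorem sub_averaging_mulVec (x : Fin N → ℝ) (v : Fin N) :
    (A - averaging μ).mulVec x v = A.mulVec x v - ∑ w, μ w * x w := by
  simp only [averaging, Matrix.sub_mulVec, Pi.sub_apply]
  simp [Matrix.mulVec, dotProduct, Matrix.vecMulVec_apply, -Matrix.vecMulVec_one, -Matrix.one_vecMulVec]

theorem IsReversible.l2Norm_sub_averaging_le (hA : IsReversible A μ) (x : Fin N → ℝ) :
    l2Norm μ ((A - averaging μ).mulVec x) ≤ l2Norm μ x := by
  refine (sq_le_sq₀ (l2Norm_nonneg _ _) (l2Norm_nonneg _ _)).1 ?_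
  rw [l2Norm_sq hA.mu_nonneg, l2Norm_sq hA.mu_nonneg]
  simp only [sub_averaging_mulVec]
  set m := ∑ w, μ w * x w with hm
  have h1 : ∑ v, μ v * (A.mulVec x v - m) ^ 2 = ∑ v, μ v * A.mulVec x v ^ 2 - m ^ 2 := by
    have : ∀ v, μ v * (A.mulVec x v - m) ^ 2 =
        μ v * A.mulVec x v ^ 2 - 2 * m * (μ v * A.mulVec x v) + m ^ 2 * μ v := fun v => by ring
    simp only [this, Finset.sum_add_distrib, Finset.sum_sub_distrib, ← Finset.mul_sum,
      hA.mu_sum, hA.sum_mulVec, ← hm]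
    ring
  rw [h1]
  have := hA.sum_sq_mulVec_le x
  nlinarith [sq_nonneg m]

theorem IsReversible.bddAbove_l2Norm (hA : IsReversible A μ) :
    BddAbove {r : ℝ | ∃ x : Fin N → ℝ, l2Norm μ x ≤ 1 ∧
      r = l2Norm μ ((A - averaging μ).mulVec x)} := by
  refine ⟨1, ?_⟩
  rintro r ⟨x, hx, rfl⟩
  exact (hA.l2Norm_sub_averaging_le x).trans hx

theorem spectralParam_nonneg (A : Matrix (Fin N) (Fin N) ℝ) (μ : Fin N → ℝ) :
    0 ≤ spectralParam A μ :=
  Real.sSup_nonneg <| by rintro r ⟨x, -, rfl⟩; exact l2Norm_nonneg _ _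

theorem IsReversible.l2Norm_le_spectralParam (hA : IsReversible A μ) (x : Fin N → ℝ) :
    l2Norm μ ((A - averaging μ).mulVec x) ≤ spectralParam A μ * l2Norm μ x := by
  rcases (l2Norm_nonneg μ x).eq_or_lt with h | h
  -- `l2Norm μ` may vanish at a nonzero `x`, where rescaling is not possible
  · rw [← h, mul_zero, h]
    exact hA.l2Norm_sub_averaging_le x
  · have h1 : l2Norm μ ((A - averaging μ).mulVec ((l2Norm μ x)⁻¹ • x)) ≤ spectralParam A μ := by
      refine le_csSup hA.bddAbove_l2Norm ⟨_, ?_, rfl⟩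
      rw [l2Norm_smul hA.mu_nonneg (inv_nonneg.2 h.le), inv_mul_cancel₀ h.ne']
    rw [Matrix.mulVec_smul, l2Norm_smul hA.mu_nonneg (inv_nonneg.2 h.le),
      inv_mul_le_iff₀ h, mul_comm] at h1
    exact h1

theorem IsReversible.sum_sq_mulVec_le_spectralParam (hA : IsReversible A μ) {g : Fin N → ℝ}
    (hg : ∑ v, μ v * g v = 0) :
    ∑ v, μ v * A.mulVec g v ^ 2 ≤ spectralParam A μ ^ 2 * ∑ v, μ v * g v ^ 2 := by
  have h := pow_le_pow_left₀ (l2Norm_nonneg _ _) (hA.l2Norm_le_spectralParam g) 2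
  rw [mul_pow, l2Norm_sq hA.mu_nonneg, l2Norm_sq hA.mu_nonneg] at h
  simpa [sub_averaging_mulVec, hg] using h

/-! ### The tilted transition operator -/

theorem exp_le_one_add_add_sq {y : ℝ} (hy : |y| ≤ 1) : Real.exp y ≤ 1 + y + y ^ 2 := by
  have := (abs_le.1 (Real.abs_exp_sub_one_sub_id_le hy)).2
  linarith

/-- The pointwise form of the bound on the tilted operator: `a` is the mean of a function, `r` the
image under `A` of its centred part, `p` the exponent of the tilt. The cross term is split so that
`r ^ 2` takes only a share `δ / 2`, which the spectral gap absorbs. -/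
theorem exp_mul_add_sq_le {a r p δ : ℝ} (hδ : 0 < δ) (hδ1 : δ ≤ 1) (hp : |p| ≤ δ / 8) :
    Real.exp p ^ 2 * (a + r) ^ 2 ≤
      a ^ 2 * (1 + 2 * p + 4 * p ^ 2) + 2 * a * r + 32 / δ * a ^ 2 * p ^ 2 + (1 + δ) * r ^ 2 := by
  have h2p : |2 * p| ≤ 1 := by rw [abs_mul, abs_two]; linarith
  have e1 := exp_le_one_add_add_sq h2p
  have e2 : |Real.exp (2 * p) - 1| ≤ 4 * |p| := by
    refine (Real.abs_exp_sub_one_le h2p).trans (le_of_eq ?_)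
    rw [abs_mul, abs_two]; ring
  have hE : Real.exp p ^ 2 = Real.exp (2 * p) := by rw [← Real.exp_nat_mul]; norm_num
  rw [hE]
  set E := Real.exp (2 * p)
  have e3 : E ≤ 1 + δ / 2 := by linarith [(abs_le.1 e2).2]
  have e4 : 2 * a * (E - 1) * r ≤ 8 * (|a| * |p|) * |r| := by
    refine (le_abs_self _).trans ?_
    rw [abs_mul, abs_mul, abs_mul, abs_two]
    nlinarith [mul_le_mul_of_nonneg_left e2 (mul_nonneg (abs_nonneg a) (abs_nonneg r))]
  have e5 : 8 * (|a| * |p|) * |r| ≤ 32 / δ * a ^ 2 * p ^ 2 + δ / 2 * r ^ 2 := by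
    rw [← sq_abs a, ← sq_abs p, ← sq_abs r]
    have h := sq_nonneg (8 * (|a| * |p|) - δ * |r|)
    have h' : 32 / δ * |a| ^ 2 * |p| ^ 2 + δ / 2 * |r| ^ 2 - 8 * (|a| * |p|) * |r| =
        (8 * (|a| * |p|) - δ * |r|) ^ 2 / (2 * δ) := by field_simp; ring
    have : 0 ≤ (8 * (|a| * |p|) - δ * |r|) ^ 2 / (2 * δ) := by positivity
    linarith
  have e6 := mul_le_mul_of_nonneg_left e1 (sq_nonneg a)
  have e7 := mul_le_mul_of_nonneg_right e3 (sq_nonneg r)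
  nlinarith

/-- The operator `h ↦ e^φ · A h`, for a small centred `φ`, has norm at most
`exp (18 E φ² / (1 - λ))` on `L₂(μ)`. The terms linear in `φ` and in the centred part of `A h`
integrate to zero, and the contraction of centred functions by `λ` pays for the cross term. -/
theorem IsReversible.l2Norm_exp_mul_mulVec_le (hA : IsReversible A μ)
    (hδ : 0 < 1 - spectralParam A μ) {φ : Fin N → ℝ} (hφ : ∀ v, |φ v| ≤ (1 - spectralParam A μ) / 8)
    (hmean : ∑ v, μ v * φ v = 0) (h : Fin N → ℝ) :
    l2Norm μ (fun v => Real.exp (φ v) * A.mulVec h v) ≤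
      Real.exp (18 / (1 - spectralParam A μ) * ∑ v, μ v * φ v ^ 2) * l2Norm μ h := by
  refine (sq_le_sq₀ (l2Norm_nonneg _ _)
    (mul_nonneg (Real.exp_pos _).le (l2Norm_nonneg _ _))).1 ?_
  rw [mul_pow, l2Norm_sq hA.mu_nonneg, l2Norm_sq hA.mu_nonneg, ← Real.exp_nat_mul]
  have hl0 := spectralParam_nonneg A μ
  set lam := spectralParam A μ with hlam
  set δ := 1 - lam with hδdef
  have hδ1 : δ ≤ 1 := by linarith
  set a := ∑ v, μ v * h v with ha
  set s := ∑ v, μ v * φ v ^ 2 with hs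
  have hs0 : 0 ≤ s := Finset.sum_nonneg fun v _ => mul_nonneg (hA.mu_nonneg v) (sq_nonneg _)
  -- split `h` into its mean `a` and its centred part `g`, so that `A h = a + A g`
  set g : Fin N → ℝ := fun v => h v - a with hg
  have hg0 : ∑ v, μ v * g v = 0 := by
    simp only [hg, mul_sub, Finset.sum_sub_distrib, ← Finset.sum_mul, hA.mu_sum, ← ha]; ring
  have hgs : ∑ v, μ v * g v ^ 2 = ∑ v, μ v * h v ^ 2 - a ^ 2 := by
    have : ∀ v, μ v * g v ^ 2 = μ v * h v ^ 2 - 2 * a * (μ v * h v) + a ^ 2 * μ v :=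
      fun v => by simp only [hg]; ring
    simp only [this, Finset.sum_add_distrib, Finset.sum_sub_distrib, ← Finset.mul_sum,
      hA.mu_sum, ← ha]
    ring
  set r := A.mulVec g with hr
  have hAh : ∀ v, A.mulVec h v = a + r v := fun v => by
    have : h = (fun _ => a) + g := by ext w; simp [hg]
    rw [this, Matrix.mulVec_add, Pi.add_apply]
    congr 1
    rw [Matrix.mulVec, dotProduct, ← Finset.sum_mul, hA.row_sum, one_mul]
  have hr0 : ∑ v, μ v * r v = 0 := by rw [hr, hA.sum_mulVec, hg0]
  have hrs := hA.sum_sq_mulVec_le_spectralParam hg0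
  rw [← hlam, ← hr] at hrs
  set b := ∑ v, μ v * g v ^ 2 with hb
  have hb0 : 0 ≤ b := Finset.sum_nonneg fun v _ => mul_nonneg (hA.mu_nonneg v) (sq_nonneg _)
  have hmain : ∑ v, μ v * (Real.exp (φ v) * A.mulVec h v) ^ 2 ≤
      a ^ 2 * (1 + 4 * s) + 32 / δ * a ^ 2 * s + (1 + δ) * ∑ v, μ v * r v ^ 2 := by
    calc ∑ v, μ v * (Real.exp (φ v) * A.mulVec h v) ^ 2
        ≤ ∑ v, μ v * (a ^ 2 * (1 + 2 * φ v + 4 * φ v ^ 2) + 2 * a * r v +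
            32 / δ * a ^ 2 * φ v ^ 2 + (1 + δ) * r v ^ 2) := by
          refine Finset.sum_le_sum fun v _ => mul_le_mul_of_nonneg_left ?_ (hA.mu_nonneg v)
          rw [hAh, mul_pow]
          exact exp_mul_add_sq_le hδ hδ1 (hφ v)
      _ = ∑ v, (a ^ 2 * μ v + 2 * a ^ 2 * (μ v * φ v) + 4 * a ^ 2 * (μ v * φ v ^ 2) +
            2 * a * (μ v * r v) + 32 / δ * a ^ 2 * (μ v * φ v ^ 2) +
            (1 + δ) * (μ v * r v ^ 2)) := Finset.sum_congr rfl fun v _ => by ring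
      _ = _ := by
          simp only [Finset.sum_add_distrib, ← Finset.mul_sum, hA.mu_sum, hmean, hr0, ← hs]
          ring
  have hexp : 1 + 36 / δ * s ≤ Real.exp ((2 : ℕ) * (18 / δ * s)) := by
    have := Real.add_one_le_exp ((2 : ℕ) * (18 / δ * s))
    refine le_trans (le_of_eq ?_) this
    push_cast; ring
  have hδs : 4 * s ≤ 4 / δ * s := by
    refine mul_le_mul_of_nonneg_right ?_ hs0
    rw [le_div_iff₀ hδ]; linarith
  have hgap : (1 + δ) * (lam ^ 2 * b) ≤ b := by
    have : lam = 1 - δ := by rw [hδdef]; ring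
    rw [this]
    have h1 : (1 + δ) * (1 - δ) ^ 2 ≤ 1 := by nlinarith [mul_pos hδ hδ, mul_pos (mul_pos hδ hδ) hδ]
    nlinarith
  have hh : ∑ v, μ v * h v ^ 2 = a ^ 2 + b := by rw [hgs]; ring
  rw [hh]
  have hq : 0 ≤ 36 / δ * s := by positivity
  calc _ ≤ a ^ 2 * (1 + 4 * s) + 32 / δ * a ^ 2 * s + (1 + δ) * ∑ v, μ v * r v ^ 2 := hmain
    _ ≤ a ^ 2 * (1 + 4 / δ * s) + 32 / δ * a ^ 2 * s + b := by
        have h1 := mul_le_mul_of_nonneg_left hrs (by linarith : (0 : ℝ) ≤ 1 + δ)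
        have h2 := mul_le_mul_of_nonneg_left hδs (sq_nonneg a)
        nlinarith
    _ = a ^ 2 * (1 + 36 / δ * s) + b := by ring
    _ ≤ (1 + 36 / δ * s) * (a ^ 2 + b) := by nlinarith [mul_nonneg hq hb0]
    _ ≤ _ := mul_le_mul_of_nonneg_right hexp (by positivity)

end MarkovChaining

namespace MarkovChaining

/-! ### Exponential moments of the chain -/

theorem integral_comp_eq_sum {Ω S : Type*} [MeasurableSpace Ω] (P : Measure Ω)
    [IsProbabilityMeasure P] [Fintype S] [MeasurableSpace S] [MeasurableSingletonClass S]
    {Z : Ω → S} (hZ : Measurable Z) (F : S → ℝ) :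
    ∫ ω, F (Z ω) ∂P = ∑ z, P.real {ω | Z ω = z} * F z := by
  have := Measure.isProbabilityMeasure_map hZ.aemeasurable (μ := P)
  have hF : Measurable F := measurable_of_finite F
  rw [← integral_map (f := F) hZ.aemeasurable hF.aestronglyMeasurable,
    integral_fintype .of_finite]
  refine Finset.sum_congr rfl fun z _ => ?_
  rw [map_measureReal_apply hZ (measurableSet_singleton z), smul_eq_mul]
  rfl

theorem integrable_comp_of_finite {Ω S : Type*} [MeasurableSpace Ω] (P : Measure Ω)
    [IsProbabilityMeasure P] [Finite S] [MeasurableSpace S] [MeasurableSingletonClass S]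
    {Z : Ω → S} (hZ : Measurable Z) (F : S → ℝ) : Integrable (fun ω => F (Z ω)) P := by
  have := Measure.isProbabilityMeasure_map hZ.aemeasurable (μ := P)
  exact Integrable.comp_measurable (f := Z) (g := F) .of_finite hZ

variable {N : ℕ} {A : Matrix (Fin N) (Fin N) ℝ} {μ : Fin N → ℝ}
  {Ω : Type*} {Y : ℕ → Ω → Fin N}

theorem abs_apply_le_norm {n : ℕ} (t : Fin n × Fin N → ℝ) (p : Fin n × Fin N) : |t p| ≤ ‖t‖ := by
  simpa using norm_le_pi_norm t p

theorem chainSum_neg {n : ℕ} (t : Fin n × Fin N → ℝ) (ω : Ω) :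
    chainSum Y (-t) ω = -chainSum Y t ω := by
  simp [chainSum]

theorem chainSum_sub {n : ℕ} (s t : Fin n × Fin N → ℝ) (ω : Ω) :
    chainSum Y (s - t) ω = chainSum Y s ω - chainSum Y t ω := by
  simp [chainSum]

theorem abs_chainSum_le {n : ℕ} (t : Fin n × Fin N → ℝ) (ω : Ω) :
    |chainSum Y t ω| ≤ n * ‖t‖ := by
  refine (Finset.abs_sum_le_sum_abs _ _).trans ?_
  refine (Finset.sum_le_sum fun i _ => abs_apply_le_norm t (i, Y i ω)).trans ?_
  simp

variable [MeasurableSpace Ω] {P : Measure Ω}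

theorem IsMarkovChain.measurable_path (hY : IsMarkovChain P A μ Y) (n : ℕ) :
    Measurable fun ω => fun j : Fin n => Y j ω :=
  measurable_pi_lambda _ fun j => hY.measurable j

theorem IsMarkovChain.measureReal_step (hY : IsMarkovChain P A μ Y) (hA : IsReversible A μ)
    (k : ℕ) (x : Fin (k + 1) → Fin N) (w : Fin N) :
    P.real {ω | ((fun j : Fin (k + 1) => Y j ω), Y (k + 1) ω) = (x, w)} =
      P.real {ω | (fun j : Fin (k + 1) => Y j ω) = x} * A (x (Fin.last k)) w := by
  -- `IsMarkovChain.step` speaks of infinite sequences: continue the path arbitrarily after `w`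
  let x' : ℕ → Fin N := fun j => if hj : j < k + 1 then x ⟨j, hj⟩ else w
  have h := hY.step k x'
  have hx' : ∀ j : Fin (k + 1), x' j = x j := fun j => dif_pos j.2
  have hw : x' (k + 1) = w := by simp [x']
  have hk : x' k = x (Fin.last k) := hx' (Fin.last k)
  have e1 : {ω | ∀ j ≤ k, Y j ω = x' j} = {ω | (fun j : Fin (k + 1) => Y j ω) = x} := by
    ext ω
    simp only [Set.mem_ofPred_eq, funext_iff, ← hx']
    exact ⟨fun H j => H j (Nat.lt_succ_iff.1 j.2), fun H j hj => H ⟨j, Nat.lt_succ_of_le hj⟩⟩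
  have e2 : {ω | ∀ j ≤ k + 1, Y j ω = x' j} =
      {ω | ((fun j : Fin (k + 1) => Y j ω), Y (k + 1) ω) = (x, w)} := by
    ext ω
    simp only [Set.mem_ofPred_eq, Prod.mk.injEq]
    have e1' : (∀ j ≤ k, Y j ω = x' j) ↔ (fun j : Fin (k + 1) => Y j ω) = x := by
      simpa using Set.ext_iff.1 e1 ω
    rw [← e1', ← hw]
    refine ⟨fun H => ⟨fun j hj => H j (by omega), H _ le_rfl⟩, fun H j hj => ?_⟩
    rcases Nat.le_succ_iff.1 hj with h | rfl
    · exact H.1 j h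
    · exact H.2
  rw [e1, e2, hk, hw] at h
  simp only [Measure.real, h, ENNReal.toReal_mul, ENNReal.toReal_ofReal (hA.nonneg _ _)]

variable [IsProbabilityMeasure P]

/-- The Markov property, integrated: given the path up to time `k`, the next value of `h` has
conditional mean `(A h) (Y k)`. -/
theorem IsMarkovChain.integral_step (hY : IsMarkovChain P A μ Y) (hA : IsReversible A μ) (k : ℕ)
    (G : (Fin (k + 1) → Fin N) → ℝ) (h : Fin N → ℝ) :
    ∫ ω, G (fun j => Y j ω) * h (Y (k + 1) ω) ∂P =
      ∫ ω, G (fun j => Y j ω) * A.mulVec h (Y k ω) ∂P := by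
  have h1 := integral_comp_eq_sum P ((hY.measurable_path (k + 1)).prodMk (hY.measurable (k + 1)))
    fun z => G z.1 * h z.2
  have h2 := integral_comp_eq_sum P (hY.measurable_path (k + 1))
    fun x => G x * A.mulVec h (x (Fin.last k))
  simp only [Fin.val_last] at h2
  rw [h1, h2, Fintype.sum_prod_type]
  refine Finset.sum_congr rfl fun x _ => ?_
  simp only [hY.measureReal_step hA, Matrix.mulVec, dotProduct, Finset.mul_sum]
  exact Finset.sum_congr rfl fun w _ => by ring

theorem IsMarkovChain.integral_init (hY : IsMarkovChain P A μ Y) (hA : IsReversible A μ)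
    (h : Fin N → ℝ) : ∫ ω, h (Y 0 ω) ∂P = ∑ v, μ v * h v := by
  rw [integral_comp_eq_sum P (hY.measurable 0)]
  exact Finset.sum_congr rfl fun v _ => by
    rw [Measure.real, hY.init, ENNReal.toReal_ofReal (hA.mu_nonneg v)]

theorem IsReversible.sum_mul_le_l2Norm (hA : IsReversible A μ) (h : Fin N → ℝ) :
    ∑ v, μ v * h v ≤ l2Norm μ h := by
  refine le_of_sq_le_sq ?_ (l2Norm_nonneg _ _)
  rw [l2Norm_sq hA.mu_nonneg]
  exact Real.pow_arith_mean_le_arith_mean_pow_of_even Finset.univ μ h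
    (fun v _ => hA.mu_nonneg v) hA.mu_sum even_two

/-- Multiplicative functionals of the path are bounded by the product of the norms of the operators
`h ↦ g i · A h`. -/
theorem IsMarkovChain.integral_prod_le (hY : IsMarkovChain P A μ Y) (hA : IsReversible A μ)
    {g : ℕ → Fin N → ℝ} {c : ℕ → ℝ}
    (hg : ∀ i h, l2Norm μ (fun v => g i v * A.mulVec h v) ≤ Real.exp (c i) * l2Norm μ h)
    (k : ℕ) (h : Fin N → ℝ) :
    ∫ ω, (∏ i ∈ Finset.range k, g i (Y i ω)) * h (Y k ω) ∂P ≤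
      Real.exp (∑ i ∈ Finset.range k, c i) * l2Norm μ h := by
  induction k generalizing h with
  | zero => simpa [hY.integral_init hA] using hA.sum_mul_le_l2Norm h
  | succ k ih =>
    have h1 := hY.integral_step hA k (fun x => ∏ i : Fin (k + 1), g i (x i)) h
    have hG : ∀ ω, ∏ i ∈ Finset.range (k + 1), g i (Y i ω) = ∏ i : Fin (k + 1), g i (Y i ω) :=
      fun ω => Finset.prod_range fun i => g i (Y i ω)
    simp only [← hG] at h1
    rw [h1]
    have h2 := ih fun v => g k v * A.mulVec h v
    simp only [Finset.prod_range_succ, Finset.sum_range_succ, mul_assoc] at h2 ⊢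
    refine h2.trans ?_
    rw [Real.exp_add, mul_assoc]
    exact mul_le_mul_of_nonneg_left (hg k h) (Real.exp_pos _).le

theorem integrable_exp_chainSum (hY : IsMarkovChain P A μ Y) {n : ℕ} (t : Fin n × Fin N → ℝ)
    (θ : ℝ) : Integrable (fun ω => Real.exp (θ * chainSum Y t ω)) P :=
  integrable_comp_of_finite P (hY.measurable_path n)
    fun x => Real.exp (θ * ∑ i : Fin n, t (i, x i))

/-- Bernstein-type bound for the Laplace transform of `W_t`. -/
theorem IsMarkovChain.mgf_chainSum_le (hY : IsMarkovChain P A μ Y) (hA : IsReversible A μ)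
    (hδ : 0 < 1 - spectralParam A μ) {n : ℕ} {t : Fin n × Fin N → ℝ}
    (ht : ∀ i, ∑ v, μ v * t (i, v) = 0) {θ : ℝ} (hθ : |θ| * ‖t‖ ≤ (1 - spectralParam A μ) / 8) :
    ProbabilityTheory.mgf (chainSum Y t) P θ ≤
      Real.exp (18 / (1 - spectralParam A μ) *
        (θ * l2Norm (fun p : Fin n × Fin N => 1 * μ p.2) t) ^ 2) := by
  set δ := 1 - spectralParam A μ with hδdef
  -- the tilt at time `i`, extended by zero to all times
  let φ : ℕ → Fin N → ℝ := fun i v => if hi : i < n then θ * t (⟨i, hi⟩, v) else 0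
  have hφ : ∀ (i : Fin n) v, φ i v = θ * t (i, v) := fun i v => by simp [φ]
  have key := hY.integral_prod_le hA (g := fun i v => Real.exp (φ i v))
    (c := fun i => 18 / δ * ∑ v, μ v * φ i v ^ 2) (fun i h => by
      refine hA.l2Norm_exp_mul_mulVec_le hδ (fun v => ?_) ?_ h
      · by_cases hi : i < n
        · simp only [φ, hi, dite_true, abs_mul]
          exact (mul_le_mul_of_nonneg_left (abs_apply_le_norm t _) (abs_nonneg θ)).trans hθ
        · simp only [φ, hi, dite_false, abs_zero]
          positivity
      · by_cases hi : i < n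
        · have := ht ⟨i, hi⟩
          simp only [φ, hi, dite_true, mul_left_comm _ θ, ← Finset.mul_sum, this, mul_zero]
        · simp [φ, hi]) n 1
  have h1 : l2Norm μ (1 : Fin N → ℝ) = 1 := by simp [l2Norm, hA.mu_sum]
  rw [h1, mul_one, ← Finset.mul_sum] at key
  simp only [Pi.one_apply, mul_one, ← Real.exp_sum,
    Finset.sum_range, hφ] at key
  have h2 : ∀ ω, ∑ i : Fin n, θ * t (i, Y i ω) = θ * chainSum Y t ω := fun ω => by
    rw [chainSum, Finset.mul_sum]
  have h3 : ∑ i : Fin n, ∑ v, μ v * (θ * t (i, v)) ^ 2 =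
      (θ * l2Norm (fun p : Fin n × Fin N => 1 * μ p.2) t) ^ 2 := by
    rw [mul_pow, l2Norm_sq fun p => by simpa using hA.mu_nonneg p.2, Fintype.sum_prod_type,
      Finset.mul_sum]
    refine Finset.sum_congr rfl fun i _ => ?_
    rw [Finset.mul_sum]
    exact Finset.sum_congr rfl fun v _ => by ring
  simp only [h2, h3] at key
  exact key

/-- The deviation that `|W_t|` exceeds with probability at most `2 exp (-25 x)`, in terms of the
`ℓ_∞` norm `a` and the `L₂` norm `b` of `t` and the spectral gap `δ`. The constant is
`344 = 8 (18 + 25)`: the `8` and the `18` come from the Laplace transform, and `25` is what the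
union bound in the chaining needs. -/
noncomputable def bernsteinRadius (δ a b x : ℝ) : ℝ :=
  344 * (x * a / δ + Real.sqrt x * b / Real.sqrt δ)

theorem bernsteinRadius_nonneg {δ a b x : ℝ} (hδ : 0 ≤ δ) (ha : 0 ≤ a) (hb : 0 ≤ b) (hx : 0 ≤ x) :
    0 ≤ bernsteinRadius δ a b x := by
  unfold bernsteinRadius; positivity

/-- Upper tail. The exponent `θ` of the Chernoff bound is the optimal Gaussian one unless this
violates the constraint `θ ‖t‖ ≤ δ / 8`, in which case `θ = δ / (8 ‖t‖)`. -/
theorem IsMarkovChain.measureReal_lt_chainSum_le (hY : IsMarkovChain P A μ Y)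
    (hA : IsReversible A μ) (hδ : 0 < 1 - spectralParam A μ) {n : ℕ} {t : Fin n × Fin N → ℝ}
    (ht : ∀ i, ∑ v, μ v * t (i, v) = 0) {x : ℝ} (hx : 0 ≤ x) :
    P.real {ω | bernsteinRadius (1 - spectralParam A μ) ‖t‖
      (l2Norm (fun p : Fin n × Fin N => 1 * μ p.2) t) x < chainSum Y t ω} ≤
        Real.exp (-(25 * x)) := by
  set δ := 1 - spectralParam A μ with hδdef
  set b := l2Norm (fun p : Fin n × Fin N => 1 * μ p.2) t with hb
  have hb0 : 0 ≤ b := l2Norm_nonneg _ _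
  rcases (norm_nonneg t).eq_or_lt with h0 | h0
  · have : {ω | bernsteinRadius δ ‖t‖ b x < chainSum Y t ω} = ∅ := by
      refine Set.eq_empty_of_forall_notMem fun ω hω => ?_
      have h1 := (le_abs_self _).trans (abs_chainSum_le (Y := Y) t ω)
      rw [← h0, mul_zero] at h1
      exact absurd (lt_of_lt_of_le hω h1)
        (bernsteinRadius_nonneg hδ.le (norm_nonneg t) hb0 hx).not_gt
    rw [this, measureReal_empty]
    exact (Real.exp_pos _).le
  have chernoff : ∀ θ, 0 ≤ θ → θ * ‖t‖ ≤ δ / 8 →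
      18 / δ * (θ * b) ^ 2 + 25 * x ≤ θ * bernsteinRadius δ ‖t‖ b x →
      P.real {ω | bernsteinRadius δ ‖t‖ b x < chainSum Y t ω} ≤ Real.exp (-(25 * x)) := by
    intro θ hθ hθ1 hθ2
    have h1 := ProbabilityTheory.measure_ge_le_exp_mul_mgf (bernsteinRadius δ ‖t‖ b x) hθ
      (integrable_exp_chainSum hY t θ)
    have h2 := hY.mgf_chainSum_le hA hδ ht (θ := θ) (by rwa [abs_of_nonneg hθ])
    refine le_trans (measureReal_mono (s₂ := {ω | bernsteinRadius δ ‖t‖ b x ≤ chainSum Y t ω})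
      fun ω hω => by rw [Set.mem_ofPred_eq] at hω ⊢; exact hω.le) (h1.trans ?_)
    refine (mul_le_mul_of_nonneg_left h2 (Real.exp_pos _).le).trans ?_
    rw [← Real.exp_add, Real.exp_le_exp]
    linarith
  have hsδ : 0 < Real.sqrt δ := Real.sqrt_pos.2 hδ
  have hsx : 0 ≤ Real.sqrt x := Real.sqrt_nonneg x
  have hδ2 : Real.sqrt δ ^ 2 = δ := Real.sq_sqrt hδ.le
  have hx2 : Real.sqrt x ^ 2 = x := Real.sq_sqrt hx
  by_cases hc : δ / (8 * ‖t‖) * b ≤ Real.sqrt x * Real.sqrt δ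
  · refine chernoff (δ / (8 * ‖t‖)) (by positivity) (le_of_eq (by field_simp)) ?_
    have h1 : 18 / δ * (δ / (8 * ‖t‖) * b) ^ 2 ≤ 18 * x := by
      have := pow_le_pow_left₀ (by positivity) hc 2
      rw [mul_pow (Real.sqrt x), hx2, hδ2] at this
      calc _ ≤ 18 / δ * (x * δ) := mul_le_mul_of_nonneg_left this (by positivity)
        _ = 18 * x := by field_simp
    have h2 : δ / (8 * ‖t‖) * bernsteinRadius δ ‖t‖ b x =
        43 * x + 344 * (δ / (8 * ‖t‖)) * (Real.sqrt x * b / Real.sqrt δ) := by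
      unfold bernsteinRadius; field_simp; ring
    rw [h2]
    have : 0 ≤ 344 * (δ / (8 * ‖t‖)) * (Real.sqrt x * b / Real.sqrt δ) := by positivity
    linarith
  · push Not at hc
    have hbpos : 0 < b := by
      rcases hb0.eq_or_lt with h | h
      · rw [← h, mul_zero] at hc
        exact absurd hc (not_lt.2 (by positivity))
      · exact h
    refine chernoff (Real.sqrt x * Real.sqrt δ / b) (by positivity) ?_ ?_
    · have h1 : Real.sqrt x * Real.sqrt δ / b ≤ δ / (8 * ‖t‖) := by
        rw [div_le_iff₀ hbpos]; exact hc.le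
      calc _ ≤ δ / (8 * ‖t‖) * ‖t‖ := mul_le_mul_of_nonneg_right h1 h0.le
        _ = δ / 8 := by field_simp
    · have h1 : 18 / δ * (Real.sqrt x * Real.sqrt δ / b * b) ^ 2 = 18 * x := by
        rw [div_mul_cancel₀ _ hbpos.ne', mul_pow, hx2, hδ2]; field_simp
      have h2 : Real.sqrt x * Real.sqrt δ / b * bernsteinRadius δ ‖t‖ b x =
          344 * x + 344 * (Real.sqrt x * Real.sqrt δ / b) * (x * ‖t‖ / δ) := by
        unfold bernsteinRadius
        rw [mul_left_comm, mul_add]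
        have : Real.sqrt x * Real.sqrt δ / b * (Real.sqrt x * b / Real.sqrt δ) = x := by
          field_simp; exact hx2
        rw [this]; ring
      rw [h1, h2]
      have : 0 ≤ 344 * (Real.sqrt x * Real.sqrt δ / b) * (x * ‖t‖ / δ) := by positivity
      linarith

theorem IsMarkovChain.measure_lt_abs_chainSum_le (hY : IsMarkovChain P A μ Y)
    (hA : IsReversible A μ) (hδ : 0 < 1 - spectralParam A μ) {n : ℕ} {t : Fin n × Fin N → ℝ}
    (ht : ∀ i, ∑ v, μ v * t (i, v) = 0) {x : ℝ} (hx : 0 ≤ x) :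
    P {ω | bernsteinRadius (1 - spectralParam A μ) ‖t‖
      (l2Norm (fun p : Fin n × Fin N => 1 * μ p.2) t) x < |chainSum Y t ω|} ≤
        ENNReal.ofReal (2 * Real.exp (-(25 * x))) := by
  have h1 := hY.measureReal_lt_chainSum_le hA hδ ht hx
  have h2 := hY.measureReal_lt_chainSum_le hA hδ (t := -t) (fun i => by simp [ht i]) hx
  simp only [norm_neg, l2Norm_neg, chainSum_neg] at h2
  simp only [lt_abs]
  rw [← ofReal_measureReal]
  refine ENNReal.ofReal_le_ofReal ((measureReal_union_le _ _).trans ?_)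
  rw [two_mul]
  exact add_le_add h1 h2

end MarkovChaining

namespace MarkovChaining

/-! ### Nets adapted to two distances -/

/-- Pseudometrics, as bare functions: `T` carries two of them, so none can be an instance. -/
structure IsPseudoDist {E : Type*} (d : E → E → ℝ) : Prop where
  nonneg : ∀ s t, 0 ≤ d s t
  symm : ∀ s t, d s t = d t s
  triangle : ∀ s t u, d s u ≤ d s t + d t u

/-- `p i` maps every point to an element of the finite set `S i ⊆ T`, and at each point of `T` the
distances to its images, with weights `w ^ i`, sum to at most `G`. The sum is bounded through its
partial sums. -/
structure IsApproximation {E : Type*} (w G : ℝ) (T : Set E) (d : E → E → ℝ) (S : ℕ → Finset E)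
    (p : ℕ → E → E) : Prop where
  card_zero : (S 0).card = 1
  card_le : ∀ i, (S i).card ≤ 2 ^ 2 ^ i
  subset : ∀ i, (S i : Set E) ⊆ T
  mem : ∀ i t, p i t ∈ S i
  sum_le : ∀ t ∈ T, ∀ m, ∑ i ∈ Finset.range m, w ^ i * d t (p i t) ≤ G

/-- A number above `γ_α` is witnessed by an admissible sequence with its nearest-point maps. -/
theorem exists_isApproximation {E : Type*} {α w G : ℝ} {T : Set E} {d : E → E → ℝ}
    (hd : IsPseudoDist d) (hw0 : 0 ≤ w) (hw : ∀ i : ℕ, (2 : ℝ) ^ ((i : ℝ) / α) = w ^ i)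
    (h : gammaFunctional α T d < ENNReal.ofReal G) :
    ∃ S p, IsApproximation w G T d S p := by
  unfold gammaFunctional at h
  simp only [iInf_lt_iff] at h
  obtain ⟨S, hS, hlt⟩ := h
  have hG : 0 ≤ G := (ENNReal.ofReal_pos.1 (lt_of_le_of_lt zero_le hlt)).le
  have hne : ∀ i, (S i).Nonempty := fun i => by
    induction i with
    | zero => exact Finset.card_pos.1 (by rw [hS.card_zero]; exact one_pos)
    | succ i ih => exact ih.mono (hS.mono i)
  choose p hp hmin using fun i t => Finset.exists_min_image (S i) (d t) (hne i)
  refine ⟨S, p, hS.card_zero, fun i => ?_, hS.subset, hp, fun t ht m => ?_⟩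
  · rcases Nat.eq_zero_or_pos i with rfl | hi
    · rw [hS.card_zero]; norm_num
    · exact hS.card_le i hi
  · have hterm : ∀ i : ℕ, ENNReal.ofReal (w ^ i * d t (p i t)) ≤
        (2 : ℝ≥0∞) ^ ((i : ℝ) / α) * ⨅ t' ∈ S i, ENNReal.ofReal (d t t') := fun i => by
      rw [ENNReal.ofReal_mul (pow_nonneg hw0 i), ← hw i, ← ENNReal.ofReal_rpow_of_pos two_pos,
        ENNReal.ofReal_ofNat]
      gcongr
      exact le_iInf₂ fun t' ht' => ENNReal.ofReal_le_ofReal (hmin i t t' ht')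
    rw [← ENNReal.ofReal_le_ofReal_iff hG, ENNReal.ofReal_sum_of_nonneg fun i _ =>
      mul_nonneg (pow_nonneg hw0 i) (hd.nonneg _ _)]
    calc _ ≤ ∑ i ∈ Finset.range m,
          (2 : ℝ≥0∞) ^ ((i : ℝ) / α) * ⨅ t' ∈ S i, ENNReal.ofReal (d t t') :=
        Finset.sum_le_sum fun i _ => hterm i
      _ ≤ _ := ENNReal.sum_le_tsum _
      _ ≤ _ := le_iSup₂ (f := fun t (_ : t ∈ T) => ∑' i : ℕ, (2 : ℝ≥0∞) ^ ((i : ℝ) / α) *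
          ⨅ t' ∈ S i, ENNReal.ofReal (d t t')) t ht
      _ ≤ _ := hlt.le

theorem IsApproximation.pow_mul_dist_le {E : Type*} {w G : ℝ} {T : Set E} {d : E → E → ℝ}
    {S : ℕ → Finset E} {p : ℕ → E → E} (h : IsApproximation w G T d S p) (hd : IsPseudoDist d)
    (hw : 1 ≤ w) {t : E} (ht : t ∈ T) (i : ℕ) : w ^ i * d t (p i t) ≤ G := by
  refine le_trans ?_ (h.sum_le t ht (i + 1))
  exact Finset.single_le_sum (f := fun i => w ^ i * d t (p i t))
    (fun j _ => mul_nonneg (pow_nonneg (by linarith) j) (hd.nonneg _ _))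
    (Finset.self_mem_range_succ i)

theorem IsApproximation.dist_le {E : Type*} {w G : ℝ} {T : Set E} {d : E → E → ℝ}
    {S : ℕ → Finset E} {p : ℕ → E → E} (h : IsApproximation w G T d S p) (hd : IsPseudoDist d)
    (hw : 1 ≤ w) {t : E} (ht : t ∈ T) (i : ℕ) : d t (p i t) ≤ G := by
  refine le_trans ?_ (h.pow_mul_dist_le hd hw ht i)
  exact le_mul_of_one_le_left (hd.nonneg _ _) (one_le_pow₀ hw)

/-- Level `0` of an approximation is a single point, close to both `s` and `t`. -/
theorem IsApproximation.dist_le_add {E : Type*} {w G : ℝ} {T : Set E} {d : E → E → ℝ}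
    {S : ℕ → Finset E} {p : ℕ → E → E} (h : IsApproximation w G T d S p) (hd : IsPseudoDist d)
    (hw : 1 ≤ w) {s : E} (hs : s ∈ T) (t : E) : d t s ≤ d t (p 0 t) + G := by
  have hp : p 0 t = p 0 s :=
    Finset.card_le_one.1 h.card_zero.le _ (h.mem 0 t) _ (h.mem 0 s)
  have h1 := hd.triangle t (p 0 t) s
  have h2 := h.dist_le hd hw hs 0
  rw [hd.symm (p 0 t) s, hp] at h1
  rw [hp]
  linarith

/-- Numbers that agree after rounding down to multiples of `G / c` differ by at most `G / c`. -/
theorem le_add_div_of_floor_eq {a b G c : ℝ} (hG : 0 < G) (hc : 0 < c) (ha : 0 ≤ a)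
    (h : ⌊c * b / G⌋₊ = ⌊c * a / G⌋₊) : b ≤ a + G / c := by
  have h1 := Nat.lt_floor_add_one (c * b / G)
  have h2 := Nat.floor_le (a := c * a / G) (by positivity)
  rw [h] at h1
  have h3 : c * b / G < c * a / G + 1 := by linarith
  have h4 : c * b < c * a + G := by
    rw [div_lt_iff₀ hG, add_mul, div_mul_cancel₀ _ hG.ne', one_mul] at h3
    exact h3
  have h5 : a + G / c = (c * a + G) / c := by field_simp
  rw [h5, le_div_iff₀ hc]
  linarith

/-- The number of cells in `exists_common_net`: two nets with `2 ^ 2 ^ i` points, and `4 ^ i + 1`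
rounded distances for each. -/
theorem card_cells_le (i : ℕ) :
    2 ^ 2 ^ i * (2 ^ 2 ^ i * ((4 ^ i + 1) * (4 ^ i + 1))) ≤ 2 ^ 2 ^ (i + 3) := by
  have h4 : 4 ^ i + 1 ≤ 2 ^ (2 * 2 ^ i) := by
    have h1 : i < 2 ^ i := Nat.lt_two_pow_self
    calc 4 ^ i + 1 ≤ 4 ^ i * 2 := by have := Nat.one_le_pow i 4 (by norm_num); omega
      _ = 2 ^ (2 * i + 1) := by rw [pow_succ, pow_mul]; norm_num
      _ ≤ _ := Nat.pow_le_pow_right two_pos (by omega)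
  calc _ ≤ 2 ^ 2 ^ i * (2 ^ 2 ^ i * (2 ^ (2 * 2 ^ i) * 2 ^ (2 * 2 ^ i))) := by gcongr
    _ = 2 ^ (6 * 2 ^ i) := by rw [← pow_add, ← pow_add, ← pow_add]; congr 1; ring
    _ ≤ _ := Nat.pow_le_pow_right two_pos (by rw [pow_add]; omega)

/-- A single net that is good for both distances. The points of `T` are sorted into cells according
to their images under `p₁ i` and `p₂ i` and to their distances from these images, rounded to
multiples of `G / 4 ^ i`; the net has one representative per cell. Recording the rounded distances
is what keeps the representative about as close to its image as the point it stands for. At level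
`0` the net can be any given point `o` of `T`. -/
theorem exists_common_net {E : Type*} {w₁ w₂ G₁ G₂ : ℝ} {T : Set E} {d₁ d₂ : E → E → ℝ}
    {S₁ S₂ : ℕ → Finset E} {p₁ p₂ : ℕ → E → E} (hd₁ : IsPseudoDist d₁) (hd₂ : IsPseudoDist d₂)
    (hw₁ : 1 ≤ w₁) (hw₂ : 1 ≤ w₂) (hG₁ : 0 < G₁) (hG₂ : 0 < G₂)
    (h₁ : IsApproximation w₁ G₁ T d₁ S₁ p₁) (h₂ : IsApproximation w₂ G₂ T d₂ S₂ p₂)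
    {o : E} (ho : o ∈ T) (i : ℕ) :
    ∃ (π : E → E) (R : Finset E), R.card ≤ 2 ^ 2 ^ (i + 3) ∧ (R : Set E) ⊆ T ∧
      (i = 0 → ∀ t, π t = o) ∧ ∀ t ∈ T, π t ∈ R ∧
        d₁ t (π t) ≤ 2 * d₁ t (p₁ i t) + G₁ / 4 ^ i ∧
        d₂ t (π t) ≤ 2 * d₂ t (p₂ i t) + G₂ / 4 ^ i := by
  classical
  rcases Nat.eq_zero_or_pos i with rfl | hi
  · refine ⟨fun _ => o, {o}, by simp, by simpa using ho, fun _ _ => rfl, fun t ht => ⟨by simp, ?_⟩⟩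
    have e₁ := h₁.dist_le_add hd₁ hw₁ ho t
    have e₂ := h₂.dist_le_add hd₂ hw₂ ho t
    have f₁ := hd₁.nonneg t (p₁ 0 t)
    have f₂ := hd₂.nonneg t (p₂ 0 t)
    simp only [pow_zero, div_one]
    constructor <;> linarith
  · have : Nonempty E := ⟨o⟩
    let κ : E → E × E × ℕ × ℕ := fun t =>
      (p₁ i t, p₂ i t, ⌊4 ^ i * d₁ t (p₁ i t) / G₁⌋₊, ⌊4 ^ i * d₂ t (p₂ i t) / G₂⌋₊)
    let K : Finset (E × E × ℕ × ℕ) :=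
      S₁ i ×ˢ S₂ i ×ˢ Finset.range (4 ^ i + 1) ×ˢ Finset.range (4 ^ i + 1)
    have hfloor : ∀ {a G : ℝ}, 0 < G → a ≤ G → ⌊4 ^ i * a / G⌋₊ ∈ Finset.range (4 ^ i + 1) := by
      intro a G hG ha
      rw [Finset.mem_range, Nat.lt_succ_iff]
      refine Nat.floor_le_of_le ?_
      rw [div_le_iff₀ hG]
      push_cast
      gcongr
    have hκK : ∀ t ∈ T, κ t ∈ K := fun t ht => by
      simp only [K, κ, Finset.mem_product]
      exact ⟨h₁.mem i t, h₂.mem i t, hfloor hG₁ (h₁.dist_le hd₁ hw₁ ht i),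
        hfloor hG₂ (h₂.dist_le hd₂ hw₂ ht i)⟩
    refine ⟨fun t => Function.invFunOn κ T (κ t),
      (K.image (Function.invFunOn κ T)).filter (· ∈ T), ?_, ?_, fun h => absurd h hi.ne',
      fun t ht => ?_⟩
    · refine (Finset.card_filter_le _ _).trans (Finset.card_image_le.trans ?_)
      simp only [K, Finset.card_product, Finset.card_range]
      refine le_trans ?_ (card_cells_le i)
      gcongr
      exacts [h₁.card_le i, h₂.card_le i]
    · intro t ht
      exact (Finset.mem_filter.1 ht).2
    · have hex : ∃ a ∈ T, κ a = κ t := ⟨t, ht, rfl⟩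
      set r := Function.invFunOn κ T (κ t) with hr
      have hrT : r ∈ T := Function.invFunOn_mem hex
      have hκ : κ r = κ t := Function.invFunOn_eq hex
      refine ⟨Finset.mem_filter.2 ⟨Finset.mem_image_of_mem _ (hκK t ht), hrT⟩, ?_⟩
      -- `r` represents the cell of `t`: same images, same rounded distances
      simp only [κ, Prod.mk.injEq] at hκ
      obtain ⟨k₁, k₂, k₃, k₄⟩ := hκ
      have h4 : (0 : ℝ) < 4 ^ i := by positivity
      have e₁ := le_add_div_of_floor_eq hG₁ h4 (hd₁.nonneg _ _) k₃
      have e₂ := le_add_div_of_floor_eq hG₂ h4 (hd₂.nonneg _ _) k₄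
      have f₁ := hd₁.triangle t (p₁ i t) r
      have f₂ := hd₂.triangle t (p₂ i t) r
      rw [k₁] at e₁
      rw [k₂] at e₂
      rw [hd₁.symm (p₁ i t) r] at f₁
      rw [hd₂.symm (p₂ i t) r] at f₂
      change d₁ t r ≤ _ ∧ d₂ t r ≤ _
      constructor <;> linarith

theorem sum_div_four_pow_le {w G : ℝ} (hw0 : 0 ≤ w) (hw : w ≤ 2) (hG : 0 ≤ G) (m : ℕ) :
    ∑ i ∈ Finset.range m, w ^ i * (G / 4 ^ i) ≤ 2 * G := by
  calc _ ≤ ∑ i ∈ Finset.range m, (1 / 2 : ℝ) ^ i * G := by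
        refine Finset.sum_le_sum fun i _ => ?_
        have : w ^ i * (G / 4 ^ i) = (w / 4) ^ i * G := by rw [div_pow]; ring
        have h2 : w / 4 ≤ 1 / 2 := by linarith
        rw [this]
        gcongr
    _ = (∑ i ∈ Finset.range m, (1 / 2 : ℝ) ^ i) * G := by rw [Finset.sum_mul]
    _ ≤ 2 * G := by
        gcongr
        exact (summable_geometric_two.sum_le_tsum _ fun i _ => by positivity).trans_eq
          tsum_geometric_two

/-- Total weighted length of the chain `π 0 t, π 1 t, …` in one of the distances. -/
theorem IsApproximation.sum_chain_le {E : Type*} {w G : ℝ} {T : Set E} {d : E → E → ℝ}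
    {S : ℕ → Finset E} {p π : ℕ → E → E} (h : IsApproximation w G T d S p) (hd : IsPseudoDist d)
    (hw1 : 1 ≤ w) (hw2 : w ≤ 2) (hG : 0 ≤ G) {t : E} (ht : t ∈ T)
    (hπ : ∀ i, d t (π i t) ≤ 2 * d t (p i t) + G / 4 ^ i) (m : ℕ) :
    ∑ i ∈ Finset.range m, w ^ i * d (π i t) (π (i + 1) t) ≤ 8 * G := by
  have hw0 : 0 ≤ w := by linarith
  have hpos : ∀ i, 0 ≤ w ^ i * d t (π i t) := fun i =>
    mul_nonneg (pow_nonneg hw0 i) (hd.nonneg _ _)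
  have hD : ∀ m, ∑ i ∈ Finset.range m, w ^ i * d t (π i t) ≤ 4 * G := fun m => by
    calc _ ≤ ∑ i ∈ Finset.range m, (2 * (w ^ i * d t (p i t)) + w ^ i * (G / 4 ^ i)) :=
          Finset.sum_le_sum fun i _ => by
            have := mul_le_mul_of_nonneg_left (hπ i) (pow_nonneg hw0 i)
            linarith
      _ ≤ 2 * G + 2 * G := by
          rw [Finset.sum_add_distrib, ← Finset.mul_sum]
          have h1 := h.sum_le t ht m
          have h2 := sum_div_four_pow_le hw0 hw2 hG m
          linarith
      _ = 4 * G := by ring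
  calc _ ≤ ∑ i ∈ Finset.range m,
        (w ^ i * d t (π i t) + w ^ (i + 1) * d t (π (i + 1) t)) := by
        refine Finset.sum_le_sum fun i _ => ?_
        have h1 := hd.triangle (π i t) t (π (i + 1) t)
        rw [hd.symm (π i t) t] at h1
        have h2 : w ^ i * d t (π (i + 1) t) ≤ w ^ (i + 1) * d t (π (i + 1) t) :=
          mul_le_mul_of_nonneg_right (pow_le_pow_right₀ hw1 i.le_succ) (hd.nonneg _ _)
        have h3 := mul_le_mul_of_nonneg_left h1 (pow_nonneg hw0 i)
        linarith
    _ ≤ 4 * G + 4 * G := by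
        rw [Finset.sum_add_distrib]
        refine add_le_add (hD m) (le_trans ?_ (hD (m + 1)))
        rw [Finset.sum_range_succ']
        exact le_add_of_nonneg_right (hpos 0)
    _ = 8 * G := by ring

end MarkovChaining

namespace MarkovChaining

/-! ### Chaining -/

variable {n N : ℕ} {A : Matrix (Fin N) (Fin N) ℝ} {μ : Fin N → ℝ}

theorem isPseudoDist_linftyDist : IsPseudoDist (linftyDist (n := n) (N := N)) where
  nonneg _ _ := norm_nonneg _
  symm _ _ := norm_sub_rev _ _
  triangle _ _ _ := norm_sub_le_norm_sub_add_norm_sub _ _ _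

theorem isPseudoDist_l2Dist (hμ : ∀ v, 0 ≤ μ v) : IsPseudoDist (l2Dist (n := n) μ) where
  nonneg _ _ := l2Norm_nonneg _ _
  symm s t := by rw [l2Dist, l2Dist, ← l2Norm_neg, neg_sub]
  triangle s t u := by
    rw [l2Dist, ← sub_add_sub_cancel s t u]
    exact l2Norm_add_le (fun p => by simpa using hμ p.2) _ _

theorem exists_isApproximation_linftyDist {T : Set (Fin n × Fin N → ℝ)} {G : ℝ}
    (h : gammaOne T < ENNReal.ofReal G) : ∃ S p, IsApproximation 2 G T linftyDist S p :=
  exists_isApproximation isPseudoDist_linftyDist two_pos.le (fun i => by simp) h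

theorem exists_isApproximation_l2Dist {T : Set (Fin n × Fin N → ℝ)} {G : ℝ}
    (hμ : ∀ v, 0 ≤ μ v) (h : gammaTwo μ T < ENNReal.ofReal G) :
    ∃ S p, IsApproximation (Real.sqrt 2) G T (l2Dist μ) S p :=
  exists_isApproximation (isPseudoDist_l2Dist hμ) (Real.sqrt_nonneg 2)
    (fun i => by
      rw [Real.sqrt_eq_rpow, ← Real.rpow_natCast, ← Real.rpow_mul two_pos.le]
      congr 1; ring) h

theorem bernsteinRadius_mul_two_pow {δ a b v : ℝ} (hv : 0 ≤ v) (i : ℕ) :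
    bernsteinRadius δ a b (v * 2 ^ i) =
      344 * (v / δ * (2 ^ i * a) + Real.sqrt v / Real.sqrt δ * (Real.sqrt 2 ^ i * b)) := by
  have : Real.sqrt (2 ^ i) = Real.sqrt 2 ^ i := by
    rw [Real.sqrt_eq_iff_mul_self_eq (by positivity) (by positivity), ← mul_pow,
      Real.mul_self_sqrt two_pos.le]
  rw [bernsteinRadius, Real.sqrt_mul hv, this]
  ring

theorem exp_neg_mul_nat_le {v : ℝ} (hv : 1 ≤ v) (i : ℕ) : Real.exp (-(v * i)) ≤ (1 / 2) ^ i := by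
  have h : Real.exp (-v) ≤ 1 / 2 := by
    rw [Real.exp_neg, ← one_div]
    exact one_div_le_one_div_of_le two_pos (by linarith [Real.add_one_le_exp v])
  calc Real.exp (-(v * i)) = Real.exp (-v) ^ i := by rw [← Real.exp_nat_mul]; congr 1; ring
    _ ≤ _ := pow_le_pow_left₀ (Real.exp_pos _).le h i

/-- The union bound at level `i`: the number of links beats no more than the factor
`exp (24 · 2 ^ i)`. -/
theorem two_pow_mul_exp_le {v : ℝ} (hv : 1 ≤ v) (i : ℕ) :
    (2 ^ 2 ^ (i + 3) * 2 ^ 2 ^ (i + 4) : ℝ) * (2 * Real.exp (-(25 * (v * 2 ^ i)))) ≤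
      2 * Real.exp (-v) * (1 / 2) ^ i := by
  have h1 : (2 ^ 2 ^ (i + 3) * 2 ^ 2 ^ (i + 4) : ℝ) ≤ Real.exp (24 * 2 ^ i) := by
    have h2 : (2 : ℝ) ≤ Real.exp 1 := by linarith [Real.add_one_le_exp 1]
    calc (2 ^ 2 ^ (i + 3) * 2 ^ 2 ^ (i + 4) : ℝ) = 2 ^ (24 * 2 ^ i) := by
          rw [← pow_add]; congr 1; ring
      _ ≤ Real.exp 1 ^ (24 * 2 ^ i) := pow_le_pow_left₀ two_pos.le h2 _
      _ = _ := by rw [← Real.exp_nat_mul]; push_cast; ring_nf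
  have h3 : (i : ℝ) + 1 ≤ 2 ^ i := by exact_mod_cast Nat.succ_le_of_lt Nat.lt_two_pow_self
  calc _ ≤ Real.exp (24 * 2 ^ i) * (2 * Real.exp (-(25 * (v * 2 ^ i)))) := by gcongr
    _ = 2 * Real.exp (24 * 2 ^ i + -(25 * (v * 2 ^ i))) := by rw [Real.exp_add]; ring
    _ ≤ 2 * Real.exp (-v + -(v * i)) := by
        refine mul_le_mul_of_nonneg_left (Real.exp_le_exp.2 ?_) two_pos.le
        have h4 : 0 ≤ (v - 1) * 2 ^ i := mul_nonneg (by linarith) (by positivity)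
        have h5 := mul_le_mul_of_nonneg_left h3 (by linarith : 0 ≤ v)
        linarith
    _ = 2 * Real.exp (-v) * Real.exp (-(v * i)) := by rw [Real.exp_add]; ring
    _ ≤ _ := by gcongr; exact exp_neg_mul_nat_le hv i

/-- If every link of the chains obeys its Bernstein bound, then the chains, summed, bound `|W_t|`
for all `t` in `T`. -/
theorem abs_chainSum_le_of_links {Ω : Type*} {Y : ℕ → Ω → Fin N} {ω : Ω} {δ v G₁ G₂ : ℝ}
    {T : Set (Fin n × Fin N → ℝ)} {S₁ S₂ : ℕ → Finset (Fin n × Fin N → ℝ)}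
    {p₁ p₂ π : ℕ → (Fin n × Fin N → ℝ) → (Fin n × Fin N → ℝ)} (hμ : ∀ v, 0 ≤ μ v)
    (hδ : 0 ≤ δ) (hv : 0 ≤ v) (hG₁ : 0 ≤ G₁) (hG₂ : 0 ≤ G₂)
    (h₁ : IsApproximation 2 G₁ T linftyDist S₁ p₁)
    (h₂ : IsApproximation (Real.sqrt 2) G₂ T (l2Dist μ) S₂ p₂) {t : Fin n × Fin N → ℝ} (ht : t ∈ T)
    (h0 : π 0 t = 0)
    (hπ₁ : ∀ i, linftyDist t (π i t) ≤ 2 * linftyDist t (p₁ i t) + G₁ / 4 ^ i)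
    (hπ₂ : ∀ i, l2Dist μ t (π i t) ≤ 2 * l2Dist μ t (p₂ i t) + G₂ / 4 ^ i)
    (hlink : ∀ i, |chainSum Y (π i t - π (i + 1) t) ω| ≤
      bernsteinRadius δ (linftyDist (π i t) (π (i + 1) t)) (l2Dist μ (π i t) (π (i + 1) t))
        (v * 2 ^ i)) :
    |chainSum Y t ω| ≤ 8 * bernsteinRadius δ G₁ G₂ v := by
  have hs2 : Real.sqrt 2 ≤ 2 := Real.sqrt_le_iff.2 ⟨by norm_num, by norm_num⟩
  have hs1 : 1 ≤ Real.sqrt 2 := Real.one_le_sqrt.2 (by norm_num)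
  have hm : ∀ m, |chainSum Y (π m t) ω| ≤ 8 * bernsteinRadius δ G₁ G₂ v := fun m => by
    have htel : chainSum Y (π m t) ω =
        -∑ i ∈ Finset.range m, chainSum Y (π i t - π (i + 1) t) ω := by
      simp only [chainSum_sub, Finset.sum_range_sub' fun i => chainSum Y (π i t) ω, h0]
      simp [chainSum]
    rw [htel, abs_neg]
    refine (Finset.abs_sum_le_sum_abs _ _).trans ((Finset.sum_le_sum fun i _ => hlink i).trans ?_)
    simp only [bernsteinRadius_mul_two_pow hv, ← Finset.mul_sum, Finset.sum_add_distrib]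
    have e₁ := h₁.sum_chain_le isPseudoDist_linftyDist one_le_two le_rfl hG₁ ht hπ₁ m
    have e₂ := h₂.sum_chain_le (isPseudoDist_l2Dist hμ) hs1 hs2 hG₂ ht hπ₂ m
    have f₁ := mul_le_mul_of_nonneg_left e₁ (div_nonneg hv hδ)
    have f₂ := mul_le_mul_of_nonneg_left e₂
      (div_nonneg (Real.sqrt_nonneg v) (Real.sqrt_nonneg δ))
    have : 8 * bernsteinRadius δ G₁ G₂ v =
        344 * (v / δ * (8 * G₁) + Real.sqrt v / Real.sqrt δ * (8 * G₂)) := by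
      unfold bernsteinRadius; ring
    rw [this]
    linarith
  -- the chain converges to `t` uniformly, hence `W` along the chain converges to `W_t`
  have hclose : ∀ m, |chainSum Y t ω - chainSum Y (π m t) ω| ≤ n * (3 * G₁) * (1 / 2) ^ m :=
    fun m => by
      rw [← chainSum_sub]
      refine (abs_chainSum_le _ _).trans ?_
      rw [mul_assoc]
      refine mul_le_mul_of_nonneg_left ?_ n.cast_nonneg
      have e1 : linftyDist t (p₁ m t) ≤ G₁ * (1 / 2) ^ m := by
        have := h₁.pow_mul_dist_le isPseudoDist_linftyDist one_le_two ht m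
        rw [one_div, inv_pow, ← div_eq_mul_inv, le_div_iff₀ (by positivity)]
        linarith
      have e2 : G₁ / 4 ^ m ≤ G₁ * (1 / 2) ^ m := by
        rw [div_eq_mul_inv, ← inv_pow]
        gcongr
        norm_num
      have := hπ₁ m
      rw [linftyDist] at this
      linarith
  have hlim : Filter.Tendsto (fun m : ℕ => 8 * bernsteinRadius δ G₁ G₂ v +
      n * (3 * G₁) * (1 / 2 : ℝ) ^ m) Filter.atTop
      (nhds (8 * bernsteinRadius δ G₁ G₂ v + n * (3 * G₁) * 0)) :=
    ((tendsto_pow_atTop_nhds_zero_of_lt_one (by norm_num) (by norm_num)).const_mul _).const_add _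
  rw [mul_zero, add_zero] at hlim
  refine ge_of_tendsto' hlim fun m => ?_
  have := abs_sub_abs_le_abs_sub (chainSum Y t ω) (chainSum Y (π m t) ω)
  linarith [hm m, hclose m]

variable {Ω : Type*} [MeasurableSpace Ω] {P : Measure Ω} [IsProbabilityMeasure P]
  {Y : ℕ → Ω → Fin N}

/-- The chaining bound: mixed tails for the supremum, in terms of any numbers above the two
functionals. -/
theorem IsMarkovChain.measure_lt_supChainSum_le (hY : IsMarkovChain P A μ Y)
    (hA : IsReversible A μ) (hδ : 0 < 1 - spectralParam A μ) {T : Set (Fin n × Fin N → ℝ)}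
    (h0 : 0 ∈ T) (hT : ∀ t ∈ T, ∀ i, ∑ v, μ v * t (i, v) = 0) {G₁ G₂ : ℝ}
    (hG₁ : gammaOne T < ENNReal.ofReal G₁) (hG₂ : gammaTwo μ T < ENNReal.ofReal G₂)
    {v : ℝ} (hv : 0 ≤ v) :
    P {ω | ENNReal.ofReal (8 * bernsteinRadius (1 - spectralParam A μ) G₁ G₂ v) <
      supChainSum Y T ω} ≤ ENNReal.ofReal (4 * Real.exp (-v)) := by
  rcases le_total v 1 with hv1 | hv1
  -- for `v ≤ 1` the right-hand side is at least `1`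
  · refine prob_le_one.trans (ENNReal.one_le_ofReal.2 ?_)
    have h1 : Real.exp v ≤ 3 :=
      (Real.exp_le_exp.2 hv1).trans (by linarith [Real.exp_one_lt_d9])
    rw [Real.exp_neg, ← div_eq_mul_inv, one_le_div (Real.exp_pos _)]
    linarith
  set δ := 1 - spectralParam A μ with hδdef
  have hG₁0 : 0 < G₁ := ENNReal.ofReal_pos.1 (lt_of_le_of_lt zero_le hG₁)
  have hG₂0 : 0 < G₂ := ENNReal.ofReal_pos.1 (lt_of_le_of_lt zero_le hG₂)
  obtain ⟨S₁, p₁, h₁⟩ := exists_isApproximation_linftyDist hG₁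
  obtain ⟨S₂, p₂, h₂⟩ := exists_isApproximation_l2Dist hA.mu_nonneg hG₂
  choose π R hcard hRT hπ0 hπ using exists_common_net isPseudoDist_linftyDist
    (isPseudoDist_l2Dist hA.mu_nonneg) one_le_two (Real.one_le_sqrt.2 (by norm_num)) hG₁0 hG₂0
    h₁ h₂ h0
  -- the event that the link `q` between levels `i` and `i + 1` violates its Bernstein bound
  let bad : ℕ → (Fin n × Fin N → ℝ) × (Fin n × Fin N → ℝ) → Set Ω := fun i q =>
    {ω | bernsteinRadius δ ‖q.1 - q.2‖
      (l2Norm (fun p : Fin n × Fin N => 1 * μ p.2) (q.1 - q.2)) (v * 2 ^ i) <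
        |chainSum Y (q.1 - q.2) ω|}
  have hsub : {ω | ENNReal.ofReal (8 * bernsteinRadius δ G₁ G₂ v) < supChainSum Y T ω} ⊆
      ⋃ i, ⋃ q ∈ R i ×ˢ R (i + 1), bad i q := by
    intro ω hω
    by_contra hgood
    rw [Set.mem_ofPred_eq] at hω
    refine absurd hω (not_lt.2 (iSup₂_le fun t ht => ENNReal.ofReal_le_ofReal ?_))
    refine abs_chainSum_le_of_links hA.mu_nonneg hδ.le hv hG₁0.le hG₂0.le h₁ h₂ ht (hπ0 0 rfl t)
      (fun i => (hπ i t ht).2.1) (fun i => (hπ i t ht).2.2) fun i => ?_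
    by_contra hi
    refine hgood (Set.mem_iUnion.2 ⟨i, Set.mem_iUnion₂.2 ⟨(π i t, π (i + 1) t), ?_, ?_⟩⟩)
    · exact Finset.mem_product.2 ⟨(hπ i t ht).1, (hπ (i + 1) t ht).1⟩
    · exact not_le.1 hi
  refine (measure_mono hsub).trans ((measure_iUnion_le _).trans ?_)
  have hlevel : ∀ i, P (⋃ q ∈ R i ×ˢ R (i + 1), bad i q) ≤
      ENNReal.ofReal (2 * Real.exp (-v) * (1 / 2) ^ i) := fun i => by
    calc _ ≤ ∑ q ∈ R i ×ˢ R (i + 1), P (bad i q) := measure_biUnion_finset_le _ _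
      _ ≤ ∑ _q ∈ R i ×ˢ R (i + 1), ENNReal.ofReal (2 * Real.exp (-(25 * (v * 2 ^ i)))) := by
          refine Finset.sum_le_sum fun q hq => ?_
          rw [Finset.mem_product] at hq
          refine hY.measure_lt_abs_chainSum_le hA hδ (fun j => ?_) (by positivity)
          simp [mul_sub, Finset.sum_sub_distrib, hT _ (hRT _ hq.1) j, hT _ (hRT _ hq.2) j]
      _ = ENNReal.ofReal (((R i).card * (R (i + 1)).card : ℝ) *
            (2 * Real.exp (-(25 * (v * 2 ^ i))))) := by
          rw [Finset.sum_const, Finset.card_product, nsmul_eq_mul, ← Nat.cast_mul,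
            ENNReal.ofReal_mul (Nat.cast_nonneg _), ENNReal.ofReal_natCast]
      _ ≤ _ := by
          refine ENNReal.ofReal_le_ofReal (le_trans ?_ (two_pow_mul_exp_le hv1 i))
          gcongr
          · exact_mod_cast hcard i
          · exact_mod_cast hcard (i + 1)
  refine (ENNReal.tsum_le_tsum hlevel).trans ?_
  rw [← ENNReal.ofReal_tsum_of_nonneg (fun i => by positivity)
    (summable_geometric_two.mul_left _), tsum_mul_left, tsum_geometric_two]
  exact ENNReal.ofReal_le_ofReal (by linarith)

end MarkovChaining

namespace MarkovChaining

/-! ### The two bounds on the supremum -/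

/-- Integrating tails: `f / B` is at most the number of integers `k ≥ 0` with `k B < f`. -/
theorem lintegral_le_of_tail {Ω : Type*} [MeasurableSpace Ω] {P : Measure Ω} {f : Ω → ℝ≥0∞}
    (hf : Measurable f) {B : ℝ} (hB : 0 < B)
    (h : ∀ k : ℕ, P {ω | ENNReal.ofReal (k * B) < f ω} ≤ ENNReal.ofReal (4 * Real.exp (-k))) :
    ∫⁻ ω, f ω ∂P ≤ ENNReal.ofReal (8 * B) := by
  let s : ℕ → Set Ω := fun k => {ω | ENNReal.ofReal (k * B) < f ω}
  have hs : ∀ k, MeasurableSet (s k) := fun k => measurableSet_lt measurable_const hf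
  have hle : ∀ ω, f ω ≤ ∑' k : ℕ, (s k).indicator (fun _ => ENNReal.ofReal B) ω := fun ω => by
    refine ENNReal.le_of_forall_nnreal_lt fun y hy => ?_
    refine le_trans ?_ (ENNReal.sum_le_tsum (Finset.range ⌈(y : ℝ) / B⌉₊))
    have hmem : ∀ k ∈ Finset.range ⌈(y : ℝ) / B⌉₊,
        (s k).indicator (fun _ => ENNReal.ofReal B) ω = ENNReal.ofReal B := fun k hk => by
      refine Set.indicator_of_mem ?_ _
      rw [Finset.mem_range, Nat.lt_ceil, lt_div_iff₀ hB] at hk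
      refine lt_of_le_of_lt ?_ hy
      rw [← ENNReal.ofReal_coe_nnreal]
      exact ENNReal.ofReal_le_ofReal hk.le
    rw [Finset.sum_congr rfl hmem, Finset.sum_const, Finset.card_range, nsmul_eq_mul,
      ← ENNReal.ofReal_natCast, ← ENNReal.ofReal_mul (Nat.cast_nonneg _),
      ← ENNReal.ofReal_coe_nnreal]
    refine ENNReal.ofReal_le_ofReal ?_
    rw [← div_le_iff₀ hB]
    exact Nat.le_ceil _
  calc ∫⁻ ω, f ω ∂P ≤ ∫⁻ ω, ∑' k : ℕ, (s k).indicator (fun _ => ENNReal.ofReal B) ω ∂P :=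
        lintegral_mono hle
    _ = ∑' k : ℕ, ENNReal.ofReal B * P (s k) := by
        rw [lintegral_tsum fun k => (measurable_const.indicator (hs k)).aemeasurable]
        simp only [lintegral_indicator_const (hs _)]
    _ ≤ ∑' k : ℕ, ENNReal.ofReal (4 * B * (1 / 2) ^ k) := by
        refine ENNReal.tsum_le_tsum fun k => ?_
        refine (mul_le_mul_right (h k) _).trans ?_
        rw [← ENNReal.ofReal_mul hB.le]
        refine ENNReal.ofReal_le_ofReal ?_
        have := exp_neg_mul_nat_le le_rfl k
        rw [one_mul] at this
        nlinarith
    _ = ENNReal.ofReal (8 * B) := by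
        rw [← ENNReal.ofReal_tsum_of_nonneg (fun k => by positivity)
          (summable_geometric_two.mul_left _), tsum_mul_left, tsum_geometric_two]
        congr 1; ring

variable {n N : ℕ} {A : Matrix (Fin N) (Fin N) ℝ} {μ : Fin N → ℝ} {Ω : Type*} [MeasurableSpace Ω]
  {P : Measure Ω} {Y : ℕ → Ω → Fin N}

/-- The supremum, even over an uncountable `T`, is a function of the finite-valued path. -/
theorem IsMarkovChain.measurable_supChainSum (hY : IsMarkovChain P A μ Y)
    (T : Set (Fin n × Fin N → ℝ)) : Measurable (supChainSum Y T) :=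
  (measurable_of_finite fun x : Fin n → Fin N =>
    ⨆ t ∈ T, ENNReal.ofReal |∑ i : Fin n, t (i, x i)|).comp (hY.measurable_path n)

variable [IsProbabilityMeasure P]

theorem IsMarkovChain.lintegral_supChainSum_le_of_lt (hY : IsMarkovChain P A μ Y)
    (hA : IsReversible A μ) (hδ : 0 < 1 - spectralParam A μ) {T : Set (Fin n × Fin N → ℝ)}
    (h0 : 0 ∈ T) (hT : ∀ t ∈ T, ∀ i, ∑ v, μ v * t (i, v) = 0) {G₁ G₂ : ℝ}
    (hG₁ : gammaOne T < ENNReal.ofReal G₁) (hG₂ : gammaTwo μ T < ENNReal.ofReal G₂) :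
    ∫⁻ ω, supChainSum Y T ω ∂P ≤ ENNReal.ofReal (22016 * (G₁ / (1 - spectralParam A μ) +
      G₂ / Real.sqrt (1 - spectralParam A μ))) := by
  have htail := fun k : ℕ => hY.measure_lt_supChainSum_le hA hδ h0 hT hG₁ hG₂ k.cast_nonneg
  set δ := 1 - spectralParam A μ with hδdef
  have hG₁0 : 0 < G₁ := ENNReal.ofReal_pos.1 (lt_of_le_of_lt zero_le hG₁)
  have hG₂0 : 0 < G₂ := ENNReal.ofReal_pos.1 (lt_of_le_of_lt zero_le hG₂)
  have hsδ : 0 < Real.sqrt δ := Real.sqrt_pos.2 hδ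
  refine (lintegral_le_of_tail (hY.measurable_supChainSum T)
    (B := 2752 * (G₁ / δ + G₂ / Real.sqrt δ)) (by positivity) fun k => ?_).trans_eq ?_
  · refine le_trans (measure_mono fun ω hω => ?_) (htail k)
    rw [Set.mem_ofPred_eq] at hω ⊢
    refine lt_of_le_of_lt (ENNReal.ofReal_le_ofReal ?_) hω
    have hk : Real.sqrt k ≤ k := by
      refine Real.sqrt_le_iff.2 ⟨k.cast_nonneg, ?_⟩
      exact_mod_cast Nat.le_self_pow two_ne_zero k
    have h1 : Real.sqrt k * (G₂ / Real.sqrt δ) ≤ k * (G₂ / Real.sqrt δ) := by gcongr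
    unfold bernsteinRadius
    rw [mul_div_assoc, mul_div_assoc]
    linarith
  · congr 1; ring

theorem IsMarkovChain.lintegral_supChainSum_le (hY : IsMarkovChain P A μ Y)
    (hA : IsReversible A μ) (hδ : 0 < 1 - spectralParam A μ) {T : Set (Fin n × Fin N → ℝ)}
    (h0 : 0 ∈ T) (hT : ∀ t ∈ T, ∀ i, ∑ v, μ v * t (i, v) = 0) :
    ∫⁻ ω, supChainSum Y T ω ∂P ≤ ENNReal.ofReal 22016 *
      (gammaOne T / ENNReal.ofReal (1 - spectralParam A μ) +
        gammaTwo μ T / ENNReal.ofReal (Real.sqrt (1 - spectralParam A μ))) := by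
  have hlt := fun G₁ G₂ => hY.lintegral_supChainSum_le_of_lt hA hδ h0 hT (G₁ := G₁) (G₂ := G₂)
  set δ := 1 - spectralParam A μ with hδdef
  have hsδ : 0 < Real.sqrt δ := Real.sqrt_pos.2 hδ
  have hC : ENNReal.ofReal 22016 ≠ 0 := (ENNReal.ofReal_pos.2 (by norm_num)).ne'
  rcases eq_or_ne (gammaOne T) ⊤ with h1 | h1
  · rw [h1, ENNReal.top_div_of_ne_top ENNReal.ofReal_ne_top, top_add, ENNReal.mul_top hC]
    exact le_top
  rcases eq_or_ne (gammaTwo μ T) ⊤ with h2 | h2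
  · rw [h2, ENNReal.top_div_of_ne_top ENNReal.ofReal_ne_top, add_top, ENNReal.mul_top hC]
    exact le_top
  have hg1 : 0 ≤ (gammaOne T).toReal := ENNReal.toReal_nonneg
  have hg2 : 0 ≤ (gammaTwo μ T).toReal := ENNReal.toReal_nonneg
  rw [← ENNReal.ofReal_toReal h1, ← ENNReal.ofReal_toReal h2] at hlt ⊢
  set g₁ := (gammaOne T).toReal
  set g₂ := (gammaTwo μ T).toReal
  rw [← ENNReal.ofReal_div_of_pos hδ, ← ENNReal.ofReal_div_of_pos hsδ,
    ← ENNReal.ofReal_add (by positivity) (by positivity), ← ENNReal.ofReal_mul (by norm_num)]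
  have hcont : Continuous fun ε : ℝ =>
      ENNReal.ofReal (22016 * ((g₁ + ε) / δ + (g₂ + ε) / Real.sqrt δ)) :=
    ENNReal.continuous_ofReal.comp (by fun_prop)
  have hlim := (hcont.tendsto 0).mono_left (nhdsWithin_le_nhds (s := Set.Ioi 0))
  simp only [add_zero] at hlim
  refine ge_of_tendsto hlim ?_
  filter_upwards [self_mem_nhdsWithin] with ε hε
  have hε : 0 < ε := hε
  exact hlt _ _ ((ENNReal.ofReal_lt_ofReal_iff (by positivity)).2 (by linarith))
    ((ENNReal.ofReal_lt_ofReal_iff (by positivity)).2 (by linarith))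

/-- The tail bound for finite functionals. Put `c = 1 / (32 · 2752²) = 1 / 242352128`. The numbers
`G₁ = 2 c δ u / v` and `G₂ = u √(2 c δ / v)` lie strictly above the functionals, and with them the
deviation in the chaining bound, `2752 (v G₁ / δ + √v G₂ / √δ)`, is less than `u`. -/
theorem IsMarkovChain.measure_le_supChainSum_le (hY : IsMarkovChain P A μ Y)
    (hA : IsReversible A μ) (hδ : 0 < 1 - spectralParam A μ) {T : Set (Fin n × Fin N → ℝ)}
    (h0 : 0 ∈ T) (hT : ∀ t ∈ T, ∀ i, ∑ v, μ v * t (i, v) = 0)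
    (h1 : gammaOne T ≠ ⊤) (h2 : gammaTwo μ T ≠ ⊤) {u v : ℝ} (hu : 0 < u) (hv : 0 ≤ v)
    (hv₁ : v * (gammaOne T).toReal ≤ 1 / 242352128 * (1 - spectralParam A μ) * u)
    (hv₂ : v * (gammaTwo μ T).toReal ^ 2 ≤ 1 / 242352128 * (1 - spectralParam A μ) * u ^ 2) :
    P {ω | ENNReal.ofReal u ≤ supChainSum Y T ω} ≤ ENNReal.ofReal (4 * Real.exp (-v)) := by
  rcases hv.eq_or_lt with rfl | hv0
  · refine prob_le_one.trans (ENNReal.one_le_ofReal.2 ?_)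
    norm_num
  have htail := fun G₁ G₂ => hY.measure_lt_supChainSum_le hA hδ h0 hT (G₁ := G₁) (G₂ := G₂)
  set δ := 1 - spectralParam A μ with hδdef
  have hsδ : 0 < Real.sqrt δ := Real.sqrt_pos.2 hδ
  have hsv : 0 < Real.sqrt v := Real.sqrt_pos.2 hv0
  have hδ2 : Real.sqrt δ ^ 2 = δ := Real.sq_sqrt hδ.le
  have hv2 : Real.sqrt v ^ 2 = v := Real.sq_sqrt hv
  rw [← ENNReal.ofReal_toReal h1, ← ENNReal.ofReal_toReal h2] at htail
  set g₁ := (gammaOne T).toReal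
  set g₂ := (gammaTwo μ T).toReal
  have hG₁ : g₁ < δ * u / (121176064 * v) := by
    rw [lt_div_iff₀ (by positivity)]
    have : 0 < δ * u := by positivity
    nlinarith
  have hG₂ : g₂ < u * Real.sqrt δ / (11008 * Real.sqrt v) := by
    refine lt_of_pow_lt_pow_left₀ 2 (by positivity) ?_
    rw [div_pow, mul_pow, mul_pow, hδ2, hv2, lt_div_iff₀ (by positivity)]
    have : 0 < δ * u ^ 2 := by positivity
    nlinarith
  refine le_trans (measure_mono fun ω hω => ?_) (htail _ _
    ((ENNReal.ofReal_lt_ofReal_iff (by positivity)).2 hG₁)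
    ((ENNReal.ofReal_lt_ofReal_iff (by positivity)).2 hG₂) hv)
  rw [Set.mem_ofPred_eq] at hω ⊢
  refine lt_of_lt_of_le ((ENNReal.ofReal_lt_ofReal_iff hu).2 ?_) hω
  have : 8 * bernsteinRadius δ (δ * u / (121176064 * v))
      (u * Real.sqrt δ / (11008 * Real.sqrt v)) v = (1 / 44032 + 1 / 4) * u := by
    unfold bernsteinRadius
    field_simp
    norm_num
  rw [this]
  linarith

/-- In the degenerate case of no spectral gap the first bound only has content if `γ₁` vanishes,
and then `T` has no nonzero element. -/
theorem eq_zero_of_gammaOne_eq_zero {T : Set (Fin n × Fin N → ℝ)} (h0 : 0 ∈ T)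
    (h : gammaOne T = 0) {t : Fin n × Fin N → ℝ} (ht : t ∈ T) : t = 0 := by
  rw [← norm_le_zero_iff]
  refine le_of_forall_pos_le_add fun ε hε => ?_
  obtain ⟨S, p, hS⟩ := exists_isApproximation_linftyDist (T := T) (G := ε / 2)
    (by rw [h]; exact ENNReal.ofReal_pos.2 (by linarith))
  have h1 := hS.dist_le_add isPseudoDist_linftyDist one_le_two h0 t
  have h2 := hS.dist_le isPseudoDist_linftyDist one_le_two ht 0
  have h3 : linftyDist t 0 = ‖t‖ := by rw [linftyDist, sub_zero]
  linarith

theorem mul_toReal_le_of_le_mul_div {v K U : ℝ} {γ : ℝ≥0∞} (hv : 0 ≤ v) (hK : 0 ≤ K) (hU : 0 ≤ U)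
    (h : ENNReal.ofReal v ≤ ENNReal.ofReal K * (ENNReal.ofReal U / γ)) :
    v * γ.toReal ≤ K * U := by
  have h1 : ENNReal.ofReal v * γ ≤ ENNReal.ofReal K * ENNReal.ofReal U := by
    refine (mul_le_mul_left h γ).trans ?_
    rw [mul_assoc]
    exact mul_le_mul_right (ENNReal.mul_le_of_le_div le_rfl) _
  have h2 := ENNReal.toReal_mono (ENNReal.mul_ne_top ENNReal.ofReal_ne_top ENNReal.ofReal_ne_top) h1
  rwa [ENNReal.toReal_mul, ENNReal.toReal_mul, ENNReal.toReal_ofReal hv, ENNReal.toReal_ofReal hK,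
    ENNReal.toReal_ofReal hU] at h2

/-- An exponential bound with an exponent in `[0, ∞]` follows from those with smaller finite
exponents. -/
theorem le_mul_exp_neg_of_forall {x m : ℝ≥0∞}
    (h : ∀ v : ℝ, 0 ≤ v → ENNReal.ofReal v ≤ m → x ≤ ENNReal.ofReal (4 * Real.exp (-v))) :
    x ≤ ENNReal.ofReal 4 * EReal.exp (-(m : EReal)) := by
  rcases eq_or_ne m ⊤ with rfl | hm
  · have hlim : Filter.Tendsto (fun v : ℝ => ENNReal.ofReal (4 * Real.exp (-v))) Filter.atTop
        (nhds (ENNReal.ofReal (4 * 0))) :=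
      (ENNReal.continuous_ofReal.tendsto _).comp (Real.tendsto_exp_neg_atTop_nhds_zero.const_mul 4)
    have := ge_of_tendsto hlim
      ((Filter.eventually_ge_atTop 0).mono fun v hv => h v hv le_top)
    simpa using this
  · have h1 := h m.toReal ENNReal.toReal_nonneg ENNReal.ofReal_toReal_le
    have h2 : (m : EReal) = ((m.toReal : ℝ) : EReal) := (EReal.coe_ennreal_toReal hm).symm
    rwa [h2, ← EReal.coe_neg, EReal.exp_coe, ← ENNReal.ofReal_mul (by norm_num)]

end MarkovChaining

theorem mainTheorem3 :
    ∃ C₁ C₂ C₃ : ℝ, 0 < C₁ ∧ 0 < C₂ ∧ 0 < C₃ ∧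
      ∀ (n N : ℕ) (A : Matrix (Fin N) (Fin N) ℝ) (μ : Fin N → ℝ),
        MarkovChaining.IsReversible A μ →
      ∀ (Ω : Type*) [MeasurableSpace Ω] (P : Measure Ω) [IsProbabilityMeasure P]
        (Y : ℕ → Ω → Fin N), MarkovChaining.IsMarkovChain P A μ Y →
      ∀ T : Set (Fin n × Fin N → ℝ),
        (∀ t ∈ T, -t ∈ T) → 0 ∈ T → (∀ t ∈ T, ∀ i, ∑ v, μ v * t (i, v) = 0) →
        (∫⁻ ω, MarkovChaining.supChainSum Y T ω ∂P ≤
          ENNReal.ofReal C₁ *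
            (MarkovChaining.gammaOne T /
                ENNReal.ofReal (1 - MarkovChaining.spectralParam A μ) +
              MarkovChaining.gammaTwo μ T /
                ENNReal.ofReal (Real.sqrt (1 - MarkovChaining.spectralParam A μ)))) ∧
        (∀ u : ℝ, 0 ≤ u →
          P {ω | ENNReal.ofReal u ≤ MarkovChaining.supChainSum Y T ω} ≤
            ENNReal.ofReal C₂ *
              EReal.exp (-((ENNReal.ofReal C₃ *
                ENNReal.ofReal (1 - MarkovChaining.spectralParam A μ) *
                min (ENNReal.ofReal u / MarkovChaining.gammaOne T)
                  (ENNReal.ofReal u ^ 2 / MarkovChaining.gammaTwo μ T ^ 2) : ℝ≥0∞) : EReal))) := by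
  refine ⟨22016, 4, 1 / 242352128, by norm_num, by norm_num, by norm_num, ?_⟩
  intro n N A μ hA Ω _ P _ Y hY T _ h0 hT
  refine ⟨?_, fun u hu => MarkovChaining.le_mul_exp_neg_of_forall fun v hv hvm => ?_⟩
  · rcases le_or_gt (1 - MarkovChaining.spectralParam A μ) 0 with hδ | hδ
    · rcases eq_or_ne (MarkovChaining.gammaOne T) 0 with h1 | h1
      · have hsup : ∀ ω, MarkovChaining.supChainSum Y T ω = 0 := fun ω => by
          rw [← nonpos_iff_eq_zero]
          refine iSup₂_le fun t ht => ?_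
          rw [MarkovChaining.eq_zero_of_gammaOne_eq_zero h0 h1 ht]
          simp [MarkovChaining.chainSum]
        simp [hsup]
      · rw [ENNReal.ofReal_of_nonpos hδ, ENNReal.div_zero h1, top_add,
          ENNReal.mul_top (ENNReal.ofReal_pos.2 (by norm_num)).ne']
        exact le_top
    · exact hY.lintegral_supChainSum_le hA hδ h0 hT
  · set m := min (ENNReal.ofReal u / MarkovChaining.gammaOne T)
      (ENNReal.ofReal u ^ 2 / MarkovChaining.gammaTwo μ T ^ 2) with hm
    -- the bound is trivial unless `u` and the spectral gap are positive and `γ₁`, `γ₂` finite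
    by_cases htriv : ENNReal.ofReal (1 - MarkovChaining.spectralParam A μ) * m = 0
    · rw [mul_assoc, htriv, mul_zero, nonpos_iff_eq_zero, ENNReal.ofReal_eq_zero] at hvm
      refine prob_le_one.trans (ENNReal.one_le_ofReal.2 ?_)
      linarith [Real.one_le_exp (neg_nonneg.2 hvm)]
    · have hδ : 0 < 1 - MarkovChaining.spectralParam A μ := by
        by_contra h
        exact htriv (by rw [ENNReal.ofReal_of_nonpos (not_lt.1 h), zero_mul])
      have hm0 : m ≠ 0 := fun h => htriv (by rw [h, mul_zero])
      have hu0 : 0 < u := by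
        refine hu.lt_of_ne' fun h => hm0 ?_
        rw [hm, h]; simp
      have h1 : MarkovChaining.gammaOne T ≠ ⊤ := fun h => hm0 (by rw [hm, h]; simp)
      have h2 : MarkovChaining.gammaTwo μ T ≠ ⊤ := fun h => hm0 (by rw [hm, h]; simp)
      have hK : 0 ≤ 1 / 242352128 * (1 - MarkovChaining.spectralParam A μ) := by positivity
      rw [← ENNReal.ofReal_mul (by norm_num)] at hvm
      refine hY.measure_le_supChainSum_le hA hδ h0 hT h1 h2 hu0 hv ?_ ?_
      · exact MarkovChaining.mul_toReal_le_of_le_mul_div hv hK hu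
          (hvm.trans (mul_le_mul_right (min_le_left _ _) _))
      · rw [← ENNReal.toReal_pow]
        refine MarkovChaining.mul_toReal_le_of_le_mul_div hv hK (sq_nonneg u)
          (hvm.trans (mul_le_mul_right ?_ _))
        rw [ENNReal.ofReal_pow hu]
        exact min_le_right _ _
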